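/- A convex body in $\mathbb{R}^n$ is a compact convex set with non-empty interior. For non-empty compact convex sets $K_1,\dots,K_n\subset\mathbb{R}^n$ let $V(K_1,\dots,K_n)$ denote their mixed volume, i.e. the symmetric coefficient in Minkowski's expansion $\operatorname{vol}\big(\sum_{i=1}^m\lambda_iK_i\big)=\sum_{i_1,\dots,i_n=1}^m\lambda_{i_1}\cdots\lambda_{i_n}V(K_{i_1},\dots,K_{i_n})$ for $\lambda_i\ge 0$; equivalently, $V(K_1,\dots,K_n)=\frac1{n!}\sum_{I\subseteq\{1,\dots,n\}}(-1)^{n+|I|}\operatorname{vol}\big(\sum_{i\in I}K_i\big)$ with Minkowski sums (the empty sum being $\{0\}$). For $0\le j\le n$ write $V(K[j],L[n-j])$ for the mixed volume of $j$ copies of $K$ and $n-j$ copies of $L$. **Corollary.** Let $K\subset\mathbb{R}^n$, $n\ge 1$, be a convex body with $\operatorname{vol}(K)=1$, and let $k$ be an integer with $0\le k\le n-1$. Then for at least $k$ of the indices $j=1,2,\dots,n-1$ one has $$V(K[j],-K[n-j])\le\frac{n-1}{n-k}\binom nj .$$ -/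

import Mathlib

open MeasureTheory

open scoped Nat NNReal

noncomputable section

namespace Godbersen

/-- `n`-dimensional Lebesgue volume of a nonempty compact convex set in `ℝⁿ`, as a real number.
(Mathlib's `ConvexBody` is a nonempty compact convex set; the interior may be empty.) -/
def vol {n : ℕ} (K : ConvexBody (EuclideanSpace ℝ (Fin n))) : ℝ :=
  volume.real (K : Set (EuclideanSpace ℝ (Fin n)))

/-- The mixed volume `V(K₁, …, Kₙ)` of `n` nonempty compact convex sets in `ℝⁿ`, by polarization of
the volume: `V(K₁, …, Kₙ) = (1 / n!) ∑_{I ⊆ {1, …, n}} (-1)^(n + |I|) vol (∑_{i ∈ I} Kᵢ)`, with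
Minkowski sums. It is the symmetric coefficient of Minkowski's volume polynomial: see
`mixedVolume_eq_of_expansion`. -/
def mixedVolume {n : ℕ} (K : Fin n → ConvexBody (EuclideanSpace ℝ (Fin n))) : ℝ :=
  (1 / (n ! : ℝ)) * ∑ I : Finset (Fin n), (-1 : ℝ) ^ (n + I.card) * vol (∑ i ∈ I, K i)

/-- `V(K[j], L[n-j])`, for `0 ≤ j ≤ n`: the mixed volume of `j` copies of `K` and `n - j` copies
of `L`. -/
def mixedVolumePair {n : ℕ} (K L : ConvexBody (EuclideanSpace ℝ (Fin n))) (j : ℕ) : ℝ :=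
  mixedVolume (fun i : Fin n => if (i : ℕ) < j then K else L)

/-- The reflected body `-K`. -/
def reflect {n : ℕ} (K : ConvexBody (EuclideanSpace ℝ (Fin n))) :
    ConvexBody (EuclideanSpace ℝ (Fin n)) :=
  (-1 : ℝ) • K

theorem coe_reflect {n : ℕ} (K : ConvexBody (EuclideanSpace ℝ (Fin n))) :
    (reflect K : Set (EuclideanSpace ℝ (Fin n))) = {x | -x ∈ K} := by
  ext x
  simp only [reflect, ConvexBody.coe_smul, Set.mem_smul_set, Set.mem_ofPred_eq, SetLike.mem_coe]
  constructor
  · rintro ⟨y, hy, rfl⟩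
    simpa using hy
  · intro hx
    exact ⟨-x, hx, by simp⟩

/-- Agreement with the description of mixed volumes as coefficients: if
`vol (∑ⱼ λⱼ Lⱼ) = ∑_{f : {1..n} → {1..m}} λ_{f 1} ⋯ λ_{f n} W f` for all `λ ≥ 0`, where `W` is
invariant under permutations of its `n` indices, then `W f = V(L_{f 1}, …, L_{f n})`. -/
theorem mixedVolume_eq_of_expansion {n m : ℕ}
    (L : Fin m → ConvexBody (EuclideanSpace ℝ (Fin n))) (W : (Fin n → Fin m) → ℝ)
    (hsymm : ∀ (f : Fin n → Fin m) (σ : Equiv.Perm (Fin n)), W (f ∘ σ) = W f)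
    (hexp : ∀ c : Fin m → ℝ≥0,
      vol (∑ j, c j • L j) = ∑ f : Fin n → Fin m, (∏ i, (c (f i) : ℝ)) * W f)
    (f : Fin n → Fin m) : mixedVolume (fun i => L (f i)) = W f := by
  classical
  have hI : ∀ I : Finset (Fin n), vol (∑ i ∈ I, L (f i)) =
      ∑ h : Fin n → Fin n, if (∀ i, h i ∈ I) then W (f ∘ h) else 0 := by
    intro I
    have h1 : ∑ i ∈ I, L (f i) = ∑ j, (∑ i ∈ I, if f i = j then (1 : ℝ≥0) else 0) • L j := by
      have h4 : ∀ j, (∑ i ∈ I, if f i = j then (1 : ℝ≥0) else 0) • L j =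
          ∑ i ∈ I, if f i = j then L j else 0 := by
        intro j
        refine (Finset.sum_smul (R := ℝ≥0)
          (M := ConvexBody (EuclideanSpace ℝ (Fin n)))).trans (Finset.sum_congr rfl fun i _ => ?_)
        split_ifs
        · exact one_smul ℝ≥0 (L j)
        · exact zero_smul ℝ≥0 (L j)
      simp only [h4]
      rw [Finset.sum_comm]
      simp
    have h2 : ∀ g : Fin n → Fin m,
        (∏ i, ((∑ k ∈ I, if f k = g i then (1 : ℝ≥0) else 0 : ℝ≥0) : ℝ)) * W g =
        ∑ h : Fin n → Fin n, if (∀ i, h i ∈ I) ∧ f ∘ h = g then W g else 0 := by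
      intro g
      have h3 : ∀ i, ((∑ k ∈ I, if f k = g i then (1 : ℝ≥0) else 0 : ℝ≥0) : ℝ) =
          ∑ k, if k ∈ I ∧ f k = g i then (1 : ℝ) else 0 := by
        intro i
        rw [NNReal.coe_sum]
        simp only [ite_and, Finset.sum_ite_mem, Finset.univ_inter]
        refine Finset.sum_congr rfl fun k _ => ?_
        split_ifs <;> rfl
      simp only [h3]
      rw [Finset.prod_univ_sum, Fintype.piFinset_univ, Finset.sum_mul]
      refine Finset.sum_congr rfl fun h _ => ?_
      rw [Finset.prod_ite_zero]
      simp only [Finset.mem_univ, forall_true_left, forall_and, funext_iff, Function.comp_apply]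
      split_ifs <;> simp
    rw [h1, hexp]
    simp only [h2]
    rw [Finset.sum_comm]
    refine Finset.sum_congr rfl fun h _ => ?_
    by_cases hh : ∀ i, h i ∈ I
    · simp [hh]
    · simp [hh]
  have hs : ∀ h : Fin n → Fin n,
      (∑ I : Finset (Fin n), (-1 : ℝ) ^ (n + I.card) * if (∀ i, h i ∈ I) then W (f ∘ h) else 0) =
      if Function.Bijective h then W f else 0 := by
    intro h
    by_cases hb : Function.Bijective h
    · rw [if_pos hb, Finset.sum_eq_single Finset.univ]
      · have := hsymm f (Equiv.ofBijective h hb)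
        simp only [Equiv.coe_ofBijective] at this
        simp [this, ← two_mul]
      · intro I _ hne
        rw [if_neg, mul_zero]
        intro hall
        apply hne
        ext x
        obtain ⟨y, rfl⟩ := hb.2 x
        simp [hall y]
      · simp
    · rw [if_neg hb]
      have hns : ¬ Function.Surjective h := fun hc => hb (Finite.surjective_iff_bijective.1 hc)
      simp only [Function.Surjective, not_forall, not_exists] at hns
      obtain ⟨x, hx⟩ := hns
      refine Finset.sum_involution (fun I _ => symmDiff I {x}) ?_ ?_ ?_ ?_
      · intro I _
        have hiff : (∀ i, h i ∈ symmDiff I {x}) ↔ ∀ i, h i ∈ I := by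
          refine forall_congr' fun i => ?_
          simp [Finset.mem_symmDiff, hx i]
        simp only [hiff]
        have hsign : (-1 : ℝ) ^ (n + (symmDiff I {x}).card) = - (-1 : ℝ) ^ (n + I.card) := by
          by_cases hxI : x ∈ I
          · have e : symmDiff I {x} = I.erase x := by
              ext y; by_cases hy : y = x <;> simp [Finset.mem_symmDiff, hy, hxI]
            rw [e, ← Finset.card_erase_add_one hxI, ← add_assoc, pow_succ]
            ring
          · have e : symmDiff I {x} = insert x I := by
              ext y; by_cases hy : y = x <;> simp [Finset.mem_symmDiff, hy, hxI]
            rw [e, Finset.card_insert_of_notMem hxI, ← add_assoc, pow_succ]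
            ring
        rw [hsign]
        ring
      · intro I _ _ heq
        have : x ∈ symmDiff I {x} ↔ x ∈ I := by rw [heq]
        simp [Finset.mem_symmDiff] at this
      · intro I _
        exact Finset.mem_univ _
      · intro I _
        simp
  have hcard : (∑ h : Fin n → Fin n, if Function.Bijective h then W f else 0) = (n ! : ℝ) * W f := by
    rw [← Finset.sum_filter, Finset.sum_const, nsmul_eq_mul]
    congr 2
    rw [← Fintype.card_subtype, ← Fintype.card_congr (Equiv.ofBijective
      (fun σ : Equiv.Perm (Fin n) => (⟨σ, σ.bijective⟩ : {h : Fin n → Fin n // Function.Bijective h}))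
      ⟨fun a b hab => Equiv.ext fun z => congrFun (congrArg Subtype.val hab) z,
        fun h => ⟨Equiv.ofBijective h.1 h.2, rfl⟩⟩), Fintype.card_perm, Fintype.card_fin]
  unfold mixedVolume
  simp only [hI, Finset.mul_sum]
  simp only [← Finset.mul_sum]
  rw [show (∑ I : Finset (Fin n), (-1 : ℝ) ^ (n + I.card) *
      ∑ h : Fin n → Fin n, if (∀ i, h i ∈ I) then W (f ∘ h) else 0) = (n ! : ℝ) * W f by
    simp only [Finset.mul_sum]
    rw [Finset.sum_comm, Finset.sum_congr rfl fun h _ => hs h, hcard]]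
  have : (n ! : ℝ) ≠ 0 := by positivity
  field_simp

end Godbersen

end

/-! Write `V j` for `V(K[j], -K[n-j])`. The key estimate is `∑ j, (1-l)^j l^(n-j) V j ≤ vol K` for
`0 < l < 1` (`sum_mixedVolumePair_reflect_le`). Integrating over `l` turns each weight into `1 /
((n+1) * n.choose j)`, so `∑ j, V j / n.choose j ≤ (n+1) vol K`. When `vol K = 1` the terms `j = 0`
and `j = n` both equal `1`, leaving at most `n - 1` for the nonnegative terms in between. If fewer
than `k` of those `n - 1` indices were good, at least `n - k` terms would exceed `(n-1)/(n-k)`, a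
contradiction.

The key estimate is of Rogers–Shephard type. The join `C` of `-lK` at height `0` and `(1-l)K` at
height `1` has slices `θ(1-l)K + (1-θ)l(-K)`, so by Minkowski's expansion and Beta integrals `(n+1)
vol C` is the sum above. A `(2n+1)`-dimensional body `Q` over `C` has volume at most `l^n (vol K)^2
n! n! / (2n+1)!`. Its fibre over `(l, 0)` contains `lK`, and convexity forces large fibres over
shrunken copies of `C`, which bounds `vol Q` below by `n! (n+1)! / (2n+1)! * vol C * l^n vol K`.
Comparing the two gives `(n+1) vol C ≤ vol K` (`measure_joinBody_le`).

Minkowski's expansion with nonnegative coefficients is obtained by transport. For the log-Laplace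
transforms `φ_K`, `φ_L`, the map `a ∇φ_K + b ∇φ_L` is injective and its range fills `aK + bL` up to
a null set. Its Jacobian is the determinant of a combination of two positive definite Hessians, a
polynomial in `a, b` whose coefficients are nonnegative multiples of mixed discriminants
(`measure_smul_add_smul_eq_sum`). -/

namespace Godbersen

/-! ### Mixed discriminants of two matrices. -/

section Determinants

variable {n : ℕ}

/-- Expansion of `det (a A + b B)` by rows. -/
theorem det_smul_add_smul (A B : Matrix (Fin n) (Fin n) ℝ) (a b : ℝ) :
    (a • A + b • B).det =
      ∑ S : Finset (Fin n), a ^ S.card * b ^ (n - S.card) * (Matrix.of (S.piecewise A B)).det := by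
  have h := (Matrix.detRowAlternating (n := Fin n) (R := ℝ)).toMultilinearMap.map_add_univ
    (a • A) (b • B)
  refine h.trans (Finset.sum_congr rfl fun S _ => ?_)
  have h1 : S.piecewise (a • A) (b • B) =
      fun i => (if i ∈ S then a else b) • S.piecewise A B i := by
    funext i
    by_cases hi : i ∈ S
    · rw [if_pos hi]
      exact (S.piecewise_eq_of_mem _ _ hi).trans
        (congrArg (a • ·) (S.piecewise_eq_of_mem A B hi).symm)
    · rw [if_neg hi]
      exact (S.piecewise_eq_of_notMem _ _ hi).trans
        (congrArg (b • ·) (S.piecewise_eq_of_notMem A B hi).symm)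
  rw [h1]
  refine ((Matrix.detRowAlternating (n := Fin n) (R := ℝ)).toMultilinearMap.map_smul_univ
    (fun i => if i ∈ S then a else b) (S.piecewise A B)).trans ?_
  rw [smul_eq_mul, Finset.prod_ite]
  simp only [Finset.prod_const]
  have h2 : (Finset.univ.filter fun i => i ∈ S).card = S.card := by simp
  have h3 : (Finset.univ.filter fun i => i ∉ S).card = n - S.card := by
    rw [← Finset.compl_filter, Finset.card_compl, h2, Fintype.card_fin]
  rw [h2, h3]
  rfl

/-- The coefficient of `a ^ j b ^ (n - j)` in `det (a A + b B)`. -/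
noncomputable def detCoeff (A B : Matrix (Fin n) (Fin n) ℝ) (j : ℕ) : ℝ :=
  ∑ S ∈ Finset.powersetCard j Finset.univ, (Matrix.of (S.piecewise A B)).det

theorem det_smul_add_smul_eq_sum_detCoeff (A B : Matrix (Fin n) (Fin n) ℝ) (a b : ℝ) :
    (a • A + b • B).det =
      ∑ j ∈ Finset.range (n + 1), a ^ j * b ^ (n - j) * detCoeff A B j := by
  rw [det_smul_add_smul, ← Finset.powerset_univ, Finset.sum_powerset, Finset.card_univ,
    Fintype.card_fin]
  refine Finset.sum_congr rfl fun j _ => ?_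
  rw [detCoeff, Finset.mul_sum]
  refine Finset.sum_congr rfl fun S hS => ?_
  rw [(Finset.mem_powersetCard.1 hS).2]

theorem coeff_prod_X_add_C_nonneg {ι : Type*} (s : Finset ι) (v : ι → ℝ) (hv : ∀ i, 0 ≤ v i)
    (k : ℕ) : 0 ≤ (∏ i ∈ s, (Polynomial.X + Polynomial.C (v i))).coeff k := by
  classical
  induction s using Finset.induction_on generalizing k with
  | empty => rw [Finset.prod_empty, Polynomial.coeff_one]; split_ifs <;> simp
  | insert i s hi ih =>
    rw [Finset.prod_insert hi, add_mul, Polynomial.coeff_add, Polynomial.coeff_C_mul]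
    refine add_nonneg ?_ (mul_nonneg (hv i) (ih k))
    cases k with
    | zero => simp
    | succ k => rw [Polynomial.coeff_X_mul]; exact ih k

open scoped MatrixOrder ComplexOrder Matrix in
/-- Mixed discriminants of positive definite matrices are nonnegative. -/
theorem detCoeff_nonneg {A B : Matrix (Fin n) (Fin n) ℝ} (hA : A.PosSemidef) (hB : B.PosDef)
    {j : ℕ} (hj : j ≤ n) : 0 ≤ detCoeff A B j := by
  obtain ⟨R, hR⟩ := CStarAlgebra.nonneg_iff_eq_star_mul_self.1
    (Matrix.nonneg_iff_posSemidef.2 hB.posSemidef)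
  have hdet : B.det = R.det ^ 2 := by
    rw [hR, Matrix.det_mul, Matrix.star_eq_conjTranspose, Matrix.det_conjTranspose, sq]
    simp
  have hRu : IsUnit R.det := by
    rw [isUnit_iff_ne_zero]
    intro h0
    have := hB.det_pos
    rw [hdet, h0] at this
    simp at this
  -- With `B = Rᴴ R`, congruence by `R⁻¹` turns `B` into the identity, so `det (A + b B)` becomes a
  -- multiple of the characteristic polynomial of `M` at `-b`, with roots `-λ` for eigenvalues `λ ≥
  -- 0` of `M`.
  set M := (R⁻¹)ᴴ * A * R⁻¹ with hM
  have hMps : M.PosSemidef := hA.conjTranspose_mul_mul_same _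
  have hAeq : A = Rᴴ * M * R := by
    have h1 : Rᴴ * (R⁻¹)ᴴ = 1 := by
      rw [← Matrix.conjTranspose_mul, Matrix.nonsing_inv_mul _ hRu, Matrix.conjTranspose_one]
    calc A = (Rᴴ * (R⁻¹)ᴴ) * A * (R⁻¹ * R) := by
          rw [h1, Matrix.nonsing_inv_mul _ hRu, one_mul, mul_one]
      _ = Rᴴ * M * R := by simp only [hM, mul_assoc]
  have hpoly : (∑ i ∈ Finset.range (n + 1),
      Polynomial.C (detCoeff A B i) * Polynomial.X ^ (n - i)) =
      Polynomial.C (R.det ^ 2) *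
        ∏ i, (Polynomial.X + Polynomial.C (hMps.1.eigenvalues i)) := by
    refine Polynomial.funext fun b => ?_
    have h1 := det_smul_add_smul_eq_sum_detCoeff A B 1 b
    have h2 : (1 : ℝ) • A + b • B = Rᴴ * (M + b • 1) * R := by
      rw [hAeq, hR, Matrix.star_eq_conjTranspose]
      simp [mul_add, add_mul]
    have h3 : (M + b • 1).det = ∏ i, (b + hMps.1.eigenvalues i) := by
      have h4 := congrArg (Polynomial.eval (-b)) hMps.1.charpoly_eq
      rw [Matrix.eval_charpoly, Polynomial.eval_prod] at h4
      have h5 : M + b • 1 = -(Matrix.scalar (Fin n) (-b) - M) := by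
        rw [neg_sub, sub_eq_add_neg, ← map_neg, neg_neg, Matrix.scalar_apply,
          Matrix.smul_one_eq_diagonal]
      rw [h5, Matrix.det_neg, h4, Fintype.card_fin]
      have h6 : ((-1 : ℝ)) ^ n = ∏ _i : Fin n, (-1 : ℝ) := by simp
      rw [h6, ← Finset.prod_mul_distrib]
      refine Finset.prod_congr rfl fun i _ => ?_
      simp
      ring
    rw [h2, Matrix.det_mul, Matrix.det_mul, h3, Matrix.det_conjTranspose] at h1
    simp only [Polynomial.eval_finsetSum, Polynomial.eval_mul, Polynomial.eval_C,
      Polynomial.eval_pow, Polynomial.eval_X, Polynomial.eval_prod, Polynomial.eval_add]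
    simp only [one_pow, one_mul, star_trivial] at h1
    rw [Finset.sum_congr rfl fun i _ => mul_comm (detCoeff A B i) (b ^ (n - i)), ← h1]
    ring
  have hc := congrArg (fun p => Polynomial.coeff p (n - j)) hpoly
  simp only [Polynomial.finsetSum_coeff, Polynomial.coeff_C_mul, Polynomial.coeff_X_pow] at hc
  rw [Finset.sum_eq_single j] at hc
  · simp only [if_true, mul_one] at hc
    rw [hc]
    exact mul_nonneg (sq_nonneg _) (coeff_prod_X_add_C_nonneg _ _ (fun i => hMps.eigenvalues_nonneg i) _)
  · intro i hi hij
    rw [if_neg, mul_zero]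
    have := Finset.mem_range.1 hi
    omega
  · intro h
    exact absurd (Finset.mem_range.2 (by omega)) h

end Determinants

/-! ### The log-Laplace transform of a compact body and its gradient. -/

section MomentMap

variable {E : Type*} [NormedAddCommGroup E] [InnerProductSpace ℝ E] [FiniteDimensional ℝ E]
  [MeasurableSpace E] [BorelSpace E] {F : Type*} [NormedAddCommGroup F] [NormedSpace ℝ F]

/-- The exponential moment `∫_K exp ⟨x, y⟩ w(y) dy`. -/
noncomputable def expMoment (K : Set E) (w : E → F) (x : E) : F :=
  ∫ y in K, Real.exp (inner ℝ x y) • w y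

theorem integrableOn_exp_smul {K : Set E} (hK : IsCompact K) {w : E → F} (hw : Continuous w)
    (x : E) : IntegrableOn (fun y => Real.exp (inner ℝ x y) • w y) K :=
  ContinuousOn.integrableOn_compact hK (by fun_prop)

/-- Differentiating brings down a factor `y`, which again gives an exponential moment with a
continuous weight. Allowing vector-valued weights lets one statement serve for the Laplace transform
(`w = 1`) and for its gradient (`w = id`). -/
theorem hasFDerivAt_expMoment {K : Set E} (hK : IsCompact K) {w : E → F} (hw : Continuous w)
    (x : E) : HasFDerivAt (expMoment K w)
      (expMoment K (fun y => (innerSL ℝ y).smulRight (w y)) x) x := by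
  obtain ⟨R, hR⟩ := hK.exists_bound_of_continuousOn (f := fun y : E => y) continuousOn_id
  obtain ⟨C, hC⟩ := hK.exists_bound_of_continuousOn hw.continuousOn
  have hcont : Continuous fun y : E => (innerSL ℝ y).smulRight (w y) := by fun_prop
  have : IsFiniteMeasure (volume.restrict K) := ⟨by simpa using hK.measure_lt_top⟩
  -- For `z` within `1` of `x` and `y ∈ K`, the exponent is at most `(‖x‖ + 1) |R|`. Absolute values
  -- are taken because the bounds `R`, `C` may be negative when `K` is empty.
  refine hasFDerivAt_integral_of_dominated_of_fderiv_le (s := Metric.ball x 1)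
    (bound := fun _ => Real.exp ((‖x‖ + 1) * |R|) * (|R| * |C|))
    (F' := fun x y => Real.exp (inner ℝ x y) • (innerSL ℝ y).smulRight (w y))
    (Metric.ball_mem_nhds _ one_pos) ?_ ?_ ?_ ?_ ?_ ?_
  · exact Filter.Eventually.of_forall fun x =>
      (integrableOn_exp_smul hK hw x).aestronglyMeasurable
  · exact integrableOn_exp_smul hK hw x
  · exact (integrableOn_exp_smul hK hcont x).aestronglyMeasurable
  · refine (ae_restrict_iff' hK.measurableSet).2 (Filter.Eventually.of_forall fun y hy z hz => ?_)
    have hyR : ‖y‖ ≤ |R| := (hR y hy).trans (le_abs_self R)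
    have hyC : ‖w y‖ ≤ |C| := (hC y hy).trans (le_abs_self C)
    have hzx : ‖z‖ ≤ ‖x‖ + 1 := by
      have h1 : ‖z - x‖ < 1 := by simpa [dist_eq_norm] using hz
      have h2 : ‖z‖ ≤ ‖x‖ + ‖z - x‖ := norm_le_norm_add_norm_sub' z x
      linarith
    rw [norm_smul, ContinuousLinearMap.norm_smulRight_apply, innerSL_apply_norm, Real.norm_eq_abs,
      Real.abs_exp]
    have h3 : inner ℝ z y ≤ (‖x‖ + 1) * |R| :=
      (real_inner_le_norm z y).trans (by gcongr)
    gcongr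
  · exact integrable_const _
  · refine Filter.Eventually.of_forall fun y z _ => ?_
    have h1 : HasFDerivAt (fun z : E => (inner ℝ z y : ℝ)) (innerSL ℝ y) z := by
      have := (innerSL ℝ y).hasFDerivAt (x := z)
      refine this.congr_of_eventuallyEq (Filter.Eventually.of_forall fun z => ?_)
      simp [real_inner_comm]
    have h2 := h1.exp.smul_const (w y)
    convert h2 using 1
    ext v
    simp [mul_smul]

/-- The Laplace transform `∫_K exp ⟨x, y⟩ dy` of `K`. -/
noncomputable def laplace (K : Set E) (x : E) : ℝ := expMoment K (fun _ => (1 : ℝ)) x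

/-- The gradient of the logarithm of the Laplace transform of `K`. -/
noncomputable def momentMap (K : Set E) (x : E) : E := (laplace K x)⁻¹ • expMoment K id x

theorem laplace_pos {K : Set E} (hK : IsCompact K) (hi : (interior K).Nonempty) (x : E) :
    0 < laplace K x := by
  have hpos : 0 < volume K :=
    (isOpen_interior.measure_pos volume hi).trans_le (measure_mono interior_subset)
  have hint := integrableOn_exp_smul hK (w := fun _ => (1 : ℝ)) continuous_const x
  unfold laplace expMoment
  rw [setIntegral_pos_iff_support_of_nonneg_ae (Filter.Eventually.of_forall fun y => by
    simp [Real.exp_nonneg]) hint]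
  have : (Function.support fun y : E => Real.exp (inner ℝ x y) • (1 : ℝ)) = Set.univ := by
    ext y; simp [Real.exp_ne_zero]
  rwa [this, Set.univ_inter]

theorem expMoment_inner {K : Set E} (hK : IsCompact K) (x u : E) :
    expMoment K (fun y => (inner ℝ y u : ℝ)) x = inner ℝ (expMoment K id x) u := by
  have h := (innerSL ℝ u).integral_comp_comm (integrableOn_exp_smul hK continuous_id x)
  simp only [innerSL_apply_apply, inner_smul_right, id] at h
  rw [real_inner_comm]
  unfold expMoment
  simp only [smul_eq_mul, id]
  rw [← h]
  simp only [real_inner_comm]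

theorem hasFDerivAt_laplace {K : Set E} (hK : IsCompact K) (x : E) :
    HasFDerivAt (laplace K) (innerSL ℝ (expMoment K id x)) x := by
  refine (hasFDerivAt_expMoment hK (w := fun _ => (1 : ℝ)) continuous_const x).congr_fderiv ?_
  ext v
  have hcont : Continuous fun y : E => (innerSL ℝ y).smulRight (1 : ℝ) := by fun_prop
  unfold expMoment
  rw [ContinuousLinearMap.integral_apply (integrableOn_exp_smul hK hcont x)]
  rw [innerSL_apply_apply]
  refine Eq.trans ?_ (expMoment_inner hK x v)
  simp [expMoment]

theorem hasFDerivAt_log_laplace {K : Set E} (hK : IsCompact K) (hi : (interior K).Nonempty)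
    (x : E) : HasFDerivAt (fun x => Real.log (laplace K x)) (innerSL ℝ (momentMap K x)) x := by
  convert (hasFDerivAt_laplace hK x).log (laplace_pos hK hi x).ne' using 1
  simp [momentMap]

theorem differentiable_momentMap {K : Set E} (hK : IsCompact K) (hi : (interior K).Nonempty) :
    Differentiable ℝ (momentMap K) := fun x =>
  ((hasFDerivAt_laplace hK x).differentiableAt.inv (laplace_pos hK hi x).ne').smul
    (hasFDerivAt_expMoment hK continuous_id x).differentiableAt

/-- The derivative of the moment map is the covariance form of the density `exp ⟨x, y⟩` on `K`. -/
theorem inner_fderiv_momentMap {K : Set E} (hK : IsCompact K) (hi : (interior K).Nonempty)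
    (x u v : E) : inner ℝ (fderiv ℝ (momentMap K) x u) v = (laplace K x)⁻¹ *
      ∫ y in K, Real.exp (inner ℝ x y) *
        ((inner ℝ y u - inner ℝ (momentMap K x) u) * (inner ℝ y v - inner ℝ (momentMap K x) v)) := by
  have hZ := (laplace_pos hK hi x).ne'
  have hd := ((hasDerivAt_inv hZ).comp_hasFDerivAt x (hasFDerivAt_laplace hK x)).smul
    (hasFDerivAt_expMoment hK continuous_id x)
  have hd' : fderiv ℝ (momentMap K) x = _ := hd.fderiv
  have hcont : Continuous fun y : E => (innerSL ℝ y).smulRight y := by fun_prop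
  have h1 : inner ℝ (expMoment K (fun y : E => (innerSL ℝ y).smulRight (id y)) x u) v =
      ∫ y in K, Real.exp (inner ℝ x y) * (inner ℝ y u * inner ℝ y v) := by
    unfold expMoment
    simp only [id]
    rw [ContinuousLinearMap.integral_apply (integrableOn_exp_smul hK hcont x), real_inner_comm,
      ← innerSL_apply_apply ℝ, ← ContinuousLinearMap.integral_comp_comm]
    · simp [real_inner_comm]
    · have := integrableOn_exp_smul hK (w := fun y : E => (inner ℝ y u : ℝ) • y) (by fun_prop) x
      simpa [IntegrableOn] using this
  have hint : ∀ w : E → ℝ, Continuous w →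
      IntegrableOn (fun y => Real.exp (inner ℝ x y) * w y) K := fun w hw =>
    integrableOn_exp_smul hK hw x
  have hm : ∀ u : E, (∫ y in K, Real.exp (inner ℝ x y) * inner ℝ y u) =
      laplace K x * inner ℝ (momentMap K x) u := by
    intro u
    have := expMoment_inner hK x u
    unfold expMoment at this
    rw [momentMap, inner_smul_left]
    simp only [smul_eq_mul] at this
    rw [this]
    simp [expMoment, hZ]
  have hz : (∫ y in K, Real.exp (inner ℝ x y)) = laplace K x := by simp [laplace, expMoment]
  set m := inner ℝ (momentMap K x) u
  set k := inner ℝ (momentMap K x) v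
  -- Covariance as second moment minus product of means, which is the shape the quotient rule
  -- produces.
  have hexp : (∫ y in K, Real.exp (inner ℝ x y) *
        ((inner ℝ y u - m) * (inner ℝ y v - k))) =
      (∫ y in K, Real.exp (inner ℝ x y) * (inner ℝ y u * inner ℝ y v)) -
        laplace K x * m * k := by
    have e : ∀ y : E, Real.exp (inner ℝ x y) * ((inner ℝ y u - m) * (inner ℝ y v - k)) =
        (Real.exp (inner ℝ x y) * (inner ℝ y u * inner ℝ y v) -
        k * (Real.exp (inner ℝ x y) * inner ℝ y u)) -
        (m * (Real.exp (inner ℝ x y) * inner ℝ y v) - (m * k) * (Real.exp (inner ℝ x y) * 1)) :=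
      fun y => by ring
    simp only [e]
    have i1 := hint (fun y => inner ℝ y u * inner ℝ y v) (by fun_prop)
    have i2 := (hint (fun y => inner ℝ y u) (by fun_prop)).const_mul k
    have i3 := (hint (fun y => inner ℝ y v) (by fun_prop)).const_mul m
    have i4 := (hint (fun y => 1) (by fun_prop)).const_mul (m * k)
    rw [integral_sub (Integrable.sub' i1 i2) (i3.sub' i4), integral_sub i1 i2, integral_sub i3 i4,
      integral_const_mul, integral_const_mul, integral_const_mul, hm, hm]
    simp only [mul_one, hz]
    ring
  rw [hexp, ← h1, hd']
  simp only [add_apply, smul_apply, Function.comp_apply,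
    ContinuousLinearMap.smulRight_apply, inner_add_left, innerSL_apply_apply]
  have hM : expMoment K id x = laplace K x • momentMap K x := by
    rw [momentMap, smul_inv_smul₀ hZ]
  simp only [hM, inner_smul_left]
  simp only [smul_eq_mul, RCLike.conj_to_real]
  change _ + _ * (_ * m) * (_ * k) = _
  field_simp
  ring

theorem fderiv_momentMap_symm {K : Set E} (hK : IsCompact K) (hi : (interior K).Nonempty)
    (x u v : E) :
    inner ℝ (fderiv ℝ (momentMap K) x u) v = inner ℝ u (fderiv ℝ (momentMap K) x v) := by
  rw [← real_inner_comm u, inner_fderiv_momentMap hK hi, inner_fderiv_momentMap hK hi]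
  simp only [mul_comm (inner ℝ _ u - inner ℝ (momentMap K x) u)]

/-- This is the variance of `⟨y, u⟩` under a positive density on `K`; it could vanish only if `K`
lay almost entirely in a hyperplane orthogonal to `u`. -/
theorem fderiv_momentMap_pos {K : Set E} (hK : IsCompact K) (hi : (interior K).Nonempty)
    (x : E) {u : E} (hu : u ≠ 0) : 0 < inner ℝ (fderiv ℝ (momentMap K) x u) u := by
  rw [inner_fderiv_momentMap hK hi]
  refine mul_pos (inv_pos.2 (laplace_pos hK hi x)) ?_
  set m := inner ℝ (momentMap K x) u
  have hcont : Continuous fun y : E => (inner ℝ y u - m) * (inner ℝ y u - m) := by fun_prop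
  rw [setIntegral_pos_iff_support_of_nonneg_ae
    (Filter.Eventually.of_forall fun y => mul_nonneg (Real.exp_nonneg _) (mul_self_nonneg _))
    (integrableOn_exp_smul hK hcont x)]
  have hs : (Function.support fun y : E =>
      Real.exp (inner ℝ x y) * ((inner ℝ y u - m) * (inner ℝ y u - m))) =
      {y | (inner ℝ y u : ℝ) ≠ m} := by
    ext y
    simp [Real.exp_ne_zero, sub_eq_zero]
  rw [hs]
  have hopen : IsOpen ({y : E | (inner ℝ y u : ℝ) ≠ m} ∩ interior K) :=
    (isOpen_ne_fun (by fun_prop) continuous_const).inter isOpen_interior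
  refine (hopen.measure_pos volume ?_).trans_le
    (measure_mono (Set.inter_subset_inter_right _ interior_subset))
  obtain ⟨q, hq⟩ := hi
  -- An interior point lying on the hyperplane is pushed off it by a small nonzero multiple of `u`.
  by_cases hqm : (inner ℝ q u : ℝ) = m
  · have ht : Filter.Tendsto (fun t : ℝ => q + t • u) (nhdsWithin 0 {0}ᶜ) (nhds q) := by
      have : Continuous fun t : ℝ => q + t • u := by fun_prop
      simpa using (this.tendsto 0).mono_left nhdsWithin_le_nhds
    have hev := ht.eventually (isOpen_interior.mem_nhds hq)
    obtain ⟨t, htK, ht0⟩ := (hev.and self_mem_nhdsWithin).exists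
    refine ⟨q + t • u, ?_, htK⟩
    simp only [Set.mem_ofPred_eq, inner_add_left, inner_smul_left, hqm]
    simpa [hu] using ht0
  · exact ⟨q, hqm, hq⟩

/-- The moment map is the barycentre of a probability measure carried by the closed convex set `K`.
-/
theorem momentMap_mem {K : Set E} (hK : IsCompact K) (hc : Convex ℝ K)
    (hi : (interior K).Nonempty) (x : E) : momentMap K x ∈ K := by
  have h1 := integrableOn_exp_smul hK (w := fun _ => (1 : ℝ)) continuous_const x
  have hexp : Integrable (fun y => Real.exp (inner ℝ x y)) (volume.restrict K) := by
    simpa [IntegrableOn] using h1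
  have : NeZero (volume.restrict K) := ⟨by
    rw [Ne, Measure.restrict_eq_zero]
    exact ((isOpen_interior.measure_pos volume hi).trans_le (measure_mono interior_subset)).ne'⟩
  have := isProbabilityMeasure_tilted hexp
  have h2 : momentMap K x = ∫ y, y ∂((volume.restrict K).tilted fun y => inner ℝ x y) := by
    rw [integral_tilted, momentMap]
    unfold laplace expMoment
    rw [← integral_smul]
    simp [div_eq_inv_mul, mul_smul]
  rw [h2]
  refine hc.integral_mem hK.isClosed ?_ ?_
  · exact (tilted_absolutelyContinuous _ _).ae_le (ae_restrict_mem hK.measurableSet)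
  · rw [integrable_tilted_iff]
    · exact integrableOn_exp_smul hK continuous_id x
    · exact hexp

/-- Coercivity of `log (laplace K x) - ⟨x, q⟩`: the integral is bounded below by its part over a
small ball in `K`, displaced from `q` in the direction of `x`. -/
theorem exists_le_log_laplace {K : Set E} (hK : IsCompact K) {q : E} (hq : q ∈ interior K) :
    ∃ ρ > 0, ∃ c : ℝ, ∀ x : E, inner ℝ x q + ρ * ‖x‖ - c ≤ Real.log (laplace K x) := by
  obtain ⟨r, hr, hball⟩ := Metric.isOpen_iff.1 isOpen_interior q hq
  refine ⟨r / 4, by positivity, -Real.log (volume.real (Metric.closedBall (0 : E) (r / 4))), ?_⟩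
  intro x
  -- The ball of radius `r / 4` about `p` stays within `3r/4` of `q`, and on it `⟨x, y⟩` exceeds
  -- `⟨x, q⟩` by at least `(r/2 - r/4) ‖x‖`. For `x = 0` the convention `0⁻¹ = 0` gives `p = q`.
  set p := q + (r / 2) • (‖x‖⁻¹ • x) with hp
  set S := Metric.closedBall p (r / 4) with hS
  have hnorm : ‖‖x‖⁻¹ • x‖ ≤ 1 := by
    rw [norm_smul, norm_inv, norm_norm]; exact inv_mul_le_one
  have hinner : inner ℝ x (‖x‖⁻¹ • x) = ‖x‖ := by
    rw [inner_smul_right, real_inner_self_eq_norm_sq]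
    rcases eq_or_ne ‖x‖ 0 with h | h
    · simp [h]
    · field_simp
  have hSK : S ⊆ K := by
    intro y hy
    refine interior_subset (hball ?_)
    have h1 : ‖y - p‖ ≤ r / 4 := by simpa [hS, dist_eq_norm] using hy
    have h2 : ‖p - q‖ ≤ r / 2 := by
      rw [hp, add_sub_cancel_left, norm_smul, Real.norm_of_nonneg (by positivity)]
      nlinarith
    rw [Metric.mem_ball, dist_eq_norm]
    have := norm_sub_le_norm_sub_add_norm_sub y p q
    linarith
  have hlow : ∀ y ∈ S, inner ℝ x q + r / 4 * ‖x‖ ≤ inner ℝ x y := by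
    intro y hy
    have h1 : ‖y - p‖ ≤ r / 4 := by simpa [hS, dist_eq_norm] using hy
    have h2 : inner ℝ x y = inner ℝ x q + r / 2 * ‖x‖ + inner ℝ x (y - p) := by
      have : inner ℝ x p = inner ℝ x q + r / 2 * ‖x‖ := by
        rw [hp, inner_add_right, inner_smul_right, hinner]
      rw [inner_sub_right, this]; ring
    have h3 : -(‖x‖ * ‖y - p‖) ≤ inner ℝ x (y - p) :=
      (abs_le.1 (abs_real_inner_le_norm x (y - p))).1
    have h4 : ‖x‖ * ‖y - p‖ ≤ ‖x‖ * (r / 4) := by gcongr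
    linarith
  have hvol : 0 < volume.real (Metric.closedBall (0 : E) (r / 4)) :=
    ENNReal.toReal_pos (Metric.measure_closedBall_pos volume _ (by positivity)).ne'
      (isCompact_closedBall _ _).measure_lt_top.ne
  have hvS : volume.real S = volume.real (Metric.closedBall (0 : E) (r / 4)) := by
    rw [measureReal_def, measureReal_def, hS, Measure.addHaar_closedBall_center]
  have hint := integrableOn_exp_smul hK (w := fun _ => (1 : ℝ)) continuous_const x
  have hZ : Real.exp (inner ℝ x q + r / 4 * ‖x‖) * volume.real S ≤ laplace K x := by
    calc Real.exp (inner ℝ x q + r / 4 * ‖x‖) * volume.real S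
        = ∫ _y in S, Real.exp (inner ℝ x q + r / 4 * ‖x‖) := by
          rw [setIntegral_const, smul_eq_mul, mul_comm]
      _ ≤ ∫ y in S, Real.exp (inner ℝ x y) • (1 : ℝ) := by
          refine setIntegral_mono_on ?_ (hint.mono_set hSK) Metric.isClosed_closedBall.measurableSet ?_
          · exact integrableOn_const (isCompact_closedBall _ _).measure_lt_top.ne
          · intro y hy
            rw [smul_eq_mul, mul_one]
            exact Real.exp_le_exp.2 (hlow y hy)
      _ ≤ laplace K x :=
          setIntegral_mono_set hint (Filter.Eventually.of_forall fun y => by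
            simp [Real.exp_nonneg]) (LE.le.eventuallyLE hSK)
  have := Real.log_le_log (by rw [hvS]; positivity) hZ
  rw [Real.log_mul (Real.exp_ne_zero _) (by rw [hvS]; exact hvol.ne'), Real.log_exp, hvS] at this
  linarith

end MomentMap

/-! ### Transport of Lebesgue measure onto `aK + bL`. -/

section MinkowskiSum

open scoped Pointwise

variable {E : Type*} [NormedAddCommGroup E] [InnerProductSpace ℝ E] [FiniteDimensional ℝ E]
  [MeasurableSpace E] [BorelSpace E]

theorem hasFDerivAt_momentMap_add {K L : Set E} (hK : IsCompact K) (hKi : (interior K).Nonempty)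
    (hL : IsCompact L) (hLi : (interior L).Nonempty) (a b : ℝ) (x : E) :
    HasFDerivAt (fun x => a • momentMap K x + b • momentMap L x)
      (a • fderiv ℝ (momentMap K) x + b • fderiv ℝ (momentMap L) x) x :=
  ((differentiable_momentMap hK hKi x).hasFDerivAt.const_smul a).add
    ((differentiable_momentMap hL hLi x).hasFDerivAt.const_smul b)

theorem inner_smul_fderiv_add_pos {K L : Set E} (hK : IsCompact K) (hKi : (interior K).Nonempty)
    (hL : IsCompact L) (hLi : (interior L).Nonempty) {a b : ℝ} (ha : 0 ≤ a) (hb : 0 ≤ b)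
    (hab : 0 < a + b) (x : E) {u : E} (hu : u ≠ 0) :
    0 < inner ℝ ((a • fderiv ℝ (momentMap K) x + b • fderiv ℝ (momentMap L) x) u) u := by
  simp only [add_apply, smul_apply, inner_add_left, real_inner_smul_left]
  have h1 := fderiv_momentMap_pos hK hKi x hu
  have h2 := fderiv_momentMap_pos hL hLi x hu
  rcases ha.lt_or_eq with ha' | ha'
  · have := mul_pos ha' h1
    have := mul_nonneg hb h2.le
    linarith
  · have := mul_pos (show 0 < b by linarith) h2
    have := mul_nonneg ha h1.le
    linarith

/-- Along the segment from `x` to `z`, the component of the map in the direction `z - x` has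
positive derivative, so its values at the two ends differ. -/
theorem injective_momentMap_add {K L : Set E} (hK : IsCompact K) (hKi : (interior K).Nonempty)
    (hL : IsCompact L) (hLi : (interior L).Nonempty) {a b : ℝ} (ha : 0 ≤ a) (hb : 0 ≤ b)
    (hab : 0 < a + b) :
    Function.Injective fun x => a • momentMap K x + b • momentMap L x := by
  intro x z hxz
  by_contra hne
  have hv : z - x ≠ 0 := sub_ne_zero.2 (Ne.symm hne)
  set G := fun x => a • momentMap K x + b • momentMap L x with hG
  have hd : ∀ t : ℝ, HasDerivAt (fun t : ℝ => (inner ℝ (G (x + t • (z - x))) (z - x) : ℝ))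
      (inner ℝ ((a • fderiv ℝ (momentMap K) (x + t • (z - x)) +
        b • fderiv ℝ (momentMap L) (x + t • (z - x))) (z - x)) (z - x)) t := by
    intro t
    have h1 : HasDerivAt (fun t : ℝ => x + t • (z - x)) (z - x) t := by
      simpa using ((hasDerivAt_id t).smul_const (z - x)).const_add x
    have h2 := (hasFDerivAt_momentMap_add hK hKi hL hLi a b (x + t • (z - x))).comp_hasDerivAt t h1
    have h3 := h2.inner ℝ (hasDerivAt_const t (z - x))
    simpa using h3
  have hmono : StrictMono (fun t : ℝ => (inner ℝ (G (x + t • (z - x))) (z - x) : ℝ)) := by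
    refine strictMono_of_deriv_pos fun t => ?_
    rw [(hd t).deriv]
    exact inner_smul_fderiv_add_pos hK hKi hL hLi ha hb hab _ hv
  have := hmono zero_lt_one
  simp only [zero_smul, add_zero, one_smul, add_sub_cancel] at this
  rw [show G x = G z from hxz] at this
  exact lt_irrefl _ this

/-- The map is the gradient of `a log (laplace K) + b log (laplace L)`. Subtracting the linear form
given by the target point leaves a coercive function, and the target is attained at its minimiser.
-/
theorem smul_interior_add_subset_range {K L : Set E} (hK : IsCompact K) (hL : IsCompact L)
    {a b : ℝ} (ha : 0 ≤ a) (hb : 0 ≤ b) (hab : 0 < a + b) :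
    a • interior K + b • interior L ⊆
      Set.range fun x => a • momentMap K x + b • momentMap L x := by
  rintro p ⟨_, ⟨q, hq, rfl⟩, _, ⟨r, hr, rfl⟩, rfl⟩
  have hKi : (interior K).Nonempty := ⟨q, hq⟩
  have hLi : (interior L).Nonempty := ⟨r, hr⟩
  obtain ⟨ρ, hρ, c, hc⟩ := exists_le_log_laplace hK hq
  obtain ⟨σ, hσ, d, hd⟩ := exists_le_log_laplace hL hr
  set f : E → ℝ := fun x => a * Real.log (laplace K x) + b * Real.log (laplace L x) -
    inner ℝ (a • q + b • r) x with hf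
  have hder : ∀ x, HasFDerivAt f (innerSL ℝ
      ((a • momentMap K x + b • momentMap L x) - (a • q + b • r))) x := by
    intro x
    have h := (((hasFDerivAt_log_laplace hK hKi x).const_mul a).add
      ((hasFDerivAt_log_laplace hL hLi x).const_mul b)).sub
        ((innerSL ℝ (a • q + b • r)).hasFDerivAt (x := x))
    refine h.congr_fderiv ?_
    simp
  have hcont : Continuous f :=
    continuous_iff_continuousAt.2 fun x => (hder x).continuousAt
  have hpos : 0 < a * ρ + b * σ := by
    rcases ha.lt_or_eq with ha' | ha'
    · have := mul_pos ha' hρ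
      have := mul_nonneg hb hσ.le
      linarith
    · have := mul_pos (show 0 < b by linarith) hσ
      have := mul_nonneg ha hρ.le
      linarith
  have hlow : ∀ x, (a * ρ + b * σ) * ‖x‖ - (a * c + b * d) ≤ f x := by
    intro x
    have h1 := mul_le_mul_of_nonneg_left (hc x) ha
    have h2 := mul_le_mul_of_nonneg_left (hd x) hb
    simp only [hf, inner_add_left, real_inner_smul_left]
    rw [real_inner_comm x q, real_inner_comm x r]
    linarith
  have htend : Filter.Tendsto f (Filter.cocompact E) Filter.atTop := by
    refine Filter.tendsto_atTop_mono hlow ?_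
    exact Filter.tendsto_atTop_add_const_right _ _
      (Filter.Tendsto.const_mul_atTop hpos tendsto_norm_cocompact_atTop)
  obtain ⟨x, hx⟩ := hcont.exists_forall_le htend
  have hmin : IsLocalMin f x := Filter.Eventually.of_forall hx
  have h0 := hmin.hasFDerivAt_eq_zero (hder x)
  refine ⟨x, ?_⟩
  have h1 := congrArg norm h0
  rw [innerSL_apply_norm, norm_zero, norm_eq_zero, sub_eq_zero] at h1
  exact h1

theorem range_momentMap_add_subset {K L : Set E} (hK : IsCompact K) (hKc : Convex ℝ K)
    (hKi : (interior K).Nonempty) (hL : IsCompact L) (hLc : Convex ℝ L)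
    (hLi : (interior L).Nonempty) (a b : ℝ) :
    (Set.range fun x => a • momentMap K x + b • momentMap L x) ⊆ a • K + b • L := by
  rintro _ ⟨x, rfl⟩
  exact Set.add_mem_add (Set.smul_mem_smul_set (momentMap_mem hK hKc hKi x))
    (Set.smul_mem_smul_set (momentMap_mem hL hLc hLi x))

/-- The range lies between `a • interior K + b • interior L` and `a • K + b • L`. The larger set is
contained in the closure of the smaller one, which is convex and so has null frontier. -/
theorem measure_range_momentMap_add {K L : Set E} (hK : IsCompact K) (hKc : Convex ℝ K)
    (hKi : (interior K).Nonempty) (hL : IsCompact L) (hLc : Convex ℝ L)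
    (hLi : (interior L).Nonempty) {a b : ℝ} (ha : 0 ≤ a) (hb : 0 ≤ b) (hab : 0 < a + b) :
    volume (Set.range fun x => a • momentMap K x + b • momentMap L x) =
      volume (a • K + b • L) := by
  refine le_antisymm (measure_mono (range_momentMap_add_subset hK hKc hKi hL hLc hLi a b)) ?_
  set U := a • interior K + b • interior L with hU
  have hUc : Convex ℝ U := (hKc.interior.smul a).add (hLc.interior.smul b)
  have hsub : a • K + b • L ⊆ closure U := by
    rintro _ ⟨_, ⟨q, hq, rfl⟩, _, ⟨r, hr, rfl⟩, rfl⟩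
    have hq' : q ∈ closure (interior K) := by
      rw [hKc.closure_interior_eq_closure_of_nonempty_interior hKi]; exact subset_closure hq
    have hr' : r ∈ closure (interior L) := by
      rw [hLc.closure_interior_eq_closure_of_nonempty_interior hLi]; exact subset_closure hr
    exact map_mem_closure₂ (f := fun q r : E => a • q + b • r) (by fun_prop) hq' hr'
      fun x hx y hy => Set.add_mem_add (Set.smul_mem_smul_set hx) (Set.smul_mem_smul_set hy)
  calc volume (a • K + b • L) ≤ volume (closure U) := measure_mono hsub
    _ ≤ volume U + volume (frontier U) := by
        rw [closure_eq_self_union_frontier]; exact measure_union_le _ _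
    _ = volume U := by rw [hUc.addHaar_frontier volume, add_zero]
    _ ≤ _ := measure_mono (smul_interior_add_subset_range hK hL ha hb hab)

theorem measure_smul_add_smul {K L : Set E} (hK : IsCompact K) (hKc : Convex ℝ K)
    (hKi : (interior K).Nonempty) (hL : IsCompact L) (hLc : Convex ℝ L)
    (hLi : (interior L).Nonempty) {a b : ℝ} (ha : 0 ≤ a) (hb : 0 ≤ b) (hab : 0 < a + b) :
    volume (a • K + b • L) = ∫⁻ x : E, ENNReal.ofReal
      |(a • fderiv ℝ (momentMap K) x + b • fderiv ℝ (momentMap L) x).det| := by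
  rw [← measure_range_momentMap_add hK hKc hKi hL hLc hLi ha hb hab, ← Set.image_univ,
    ← lintegral_abs_det_fderiv_eq_addHaar_image volume MeasurableSet.univ
      (fun x _ => (hasFDerivAt_momentMap_add hK hKi hL hLi a b x).hasFDerivWithinAt)
      (injective_momentMap_add hK hKi hL hLi ha hb hab).injOn, Measure.restrict_univ]

end MinkowskiSum

/-! ### Minkowski's volume polynomial for two bodies. -/

section Hessian

open scoped Pointwise Matrix

variable {n : ℕ}

/-- The matrix of the derivative of the moment map of `K`. -/
noncomputable def momentHessian (K : Set (EuclideanSpace ℝ (Fin n)))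
    (x : EuclideanSpace ℝ (Fin n)) : Matrix (Fin n) (Fin n) ℝ :=
  LinearMap.toMatrix (EuclideanSpace.basisFun (Fin n) ℝ).toBasis
    (EuclideanSpace.basisFun (Fin n) ℝ).toBasis (fderiv ℝ (momentMap K) x).toLinearMap

theorem momentHessian_apply (K : Set (EuclideanSpace ℝ (Fin n))) (x : EuclideanSpace ℝ (Fin n))
    (i j : Fin n) : momentHessian K x i j =
      fderiv ℝ (momentMap K) x (EuclideanSpace.basisFun (Fin n) ℝ j) i := by
  simp [momentHessian, LinearMap.toMatrix_apply]

theorem posDef_momentHessian {K : Set (EuclideanSpace ℝ (Fin n))} (hK : IsCompact K)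
    (hi : (interior K).Nonempty) (x : EuclideanSpace ℝ (Fin n)) :
    (momentHessian K x).PosDef := by
  refine Matrix.PosDef.of_dotProduct_mulVec_pos ?_ ?_
  · ext i j
    have h := fderiv_momentMap_symm hK hi x (EuclideanSpace.basisFun (Fin n) ℝ i)
      (EuclideanSpace.basisFun (Fin n) ℝ j)
    simp only [EuclideanSpace.basisFun_apply, EuclideanSpace.inner_single_left,
      EuclideanSpace.inner_single_right] at h
    simpa [momentHessian_apply] using h
  · intro w hw
    have hw' : WithLp.toLp 2 w ≠ 0 := by simpa using hw
    have h := fderiv_momentMap_pos hK hi x hw'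
    have h2 : momentHessian K x *ᵥ w = (fderiv ℝ (momentMap K) x (WithLp.toLp 2 w)).ofLp := by
      have := LinearMap.toMatrix_mulVec_repr (EuclideanSpace.basisFun (Fin n) ℝ).toBasis
        (EuclideanSpace.basisFun (Fin n) ℝ).toBasis (fderiv ℝ (momentMap K) x).toLinearMap
        (WithLp.toLp 2 w)
      exact this
    rw [h2]
    rw [EuclideanSpace.inner_eq_star_dotProduct] at h
    simpa [dotProduct_comm] using h

theorem measurable_momentHessian (K : Set (EuclideanSpace ℝ (Fin n))) (i j : Fin n) :
    Measurable fun x => momentHessian K x i j := by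
  simp only [momentHessian_apply]
  have h := measurable_fderiv_apply_const ℝ (momentMap K) (EuclideanSpace.basisFun (Fin n) ℝ j)
  fun_prop

theorem measurable_detCoeff_momentHessian (K L : Set (EuclideanSpace ℝ (Fin n))) (j : ℕ) :
    Measurable fun x => detCoeff (momentHessian K x) (momentHessian L x) j := by
  unfold detCoeff
  refine Finset.measurable_sum _ fun S _ => ?_
  simp only [Matrix.det_apply]
  refine Finset.measurable_sum _ fun σ _ => Measurable.const_smul ?_ _
  refine Finset.measurable_prod _ fun i _ => ?_
  by_cases hi : σ i ∈ S
  · have h : (fun x => Matrix.of (S.piecewise (momentHessian K x) (momentHessian L x)) (σ i) i) =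
        fun x => momentHessian K x (σ i) i := by
      funext x
      exact congrFun (S.piecewise_eq_of_mem (momentHessian K x) (momentHessian L x) hi) i
    rw [h]
    exact measurable_momentHessian K (σ i) i
  · have h : (fun x => Matrix.of (S.piecewise (momentHessian K x) (momentHessian L x)) (σ i) i) =
        fun x => momentHessian L x (σ i) i := by
      funext x
      exact congrFun (S.piecewise_eq_of_notMem (momentHessian K x) (momentHessian L x) hi) i
    rw [h]
    exact measurable_momentHessian L (σ i) i

/-- The coefficient of `a ^ j b ^ (n - j)` in the volume of `a K + b L`. -/
noncomputable def volCoeff (K L : Set (EuclideanSpace ℝ (Fin n))) (j : ℕ) : ENNReal :=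
  ∫⁻ x, ENNReal.ofReal (detCoeff (momentHessian K x) (momentHessian L x) j)

/-- Minkowski's theorem: the volume of `a K + b L` is a homogeneous polynomial in `a, b ≥ 0` with
nonnegative coefficients. -/
theorem measure_smul_add_smul_eq_sum {K L : Set (EuclideanSpace ℝ (Fin n))} (hK : IsCompact K)
    (hKc : Convex ℝ K) (hKi : (interior K).Nonempty) (hL : IsCompact L) (hLc : Convex ℝ L)
    (hLi : (interior L).Nonempty) {a b : ℝ} (ha : 0 ≤ a) (hb : 0 ≤ b) (hab : 0 < a + b) :
    volume (a • K + b • L) =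
      ∑ j ∈ Finset.range (n + 1), ENNReal.ofReal (a ^ j * b ^ (n - j)) * volCoeff K L j := by
  rw [measure_smul_add_smul hK hKc hKi hL hLc hLi ha hb hab]
  -- Nonnegativity of each coefficient removes the absolute value from the Jacobian and lets the sum
  -- leave the lower integral without any integrability argument.
  have hnn : ∀ x, ∀ j ∈ Finset.range (n + 1),
      0 ≤ detCoeff (momentHessian K x) (momentHessian L x) j := fun x j hj =>
    detCoeff_nonneg (posDef_momentHessian hK hKi x).posSemidef (posDef_momentHessian hL hLi x)
      (by have := Finset.mem_range.1 hj; omega)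
  have hdet : ∀ x, (a • fderiv ℝ (momentMap K) x + b • fderiv ℝ (momentMap L) x).det =
      ∑ j ∈ Finset.range (n + 1),
        a ^ j * b ^ (n - j) * detCoeff (momentHessian K x) (momentHessian L x) j := by
    intro x
    rw [← det_smul_add_smul_eq_sum_detCoeff, momentHessian, momentHessian, ← map_smul, ← map_smul,
      ← map_add, LinearMap.det_toMatrix]
    rfl
  have hcoef : ∀ j, 0 ≤ a ^ j * b ^ (n - j) := fun j => by positivity
  simp only [hdet]
  have h1 : ∀ x, ENNReal.ofReal |∑ j ∈ Finset.range (n + 1),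
        a ^ j * b ^ (n - j) * detCoeff (momentHessian K x) (momentHessian L x) j| =
      ∑ j ∈ Finset.range (n + 1), ENNReal.ofReal (a ^ j * b ^ (n - j)) *
        ENNReal.ofReal (detCoeff (momentHessian K x) (momentHessian L x) j) := by
    intro x
    rw [abs_of_nonneg (Finset.sum_nonneg fun j hj => mul_nonneg (hcoef j) (hnn x j hj)),
      ENNReal.ofReal_sum_of_nonneg fun j hj => mul_nonneg (hcoef j) (hnn x j hj)]
    exact Finset.sum_congr rfl fun j _ => ENNReal.ofReal_mul (hcoef j)
  simp only [h1]
  rw [lintegral_finsetSum]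
  · refine Finset.sum_congr rfl fun j _ => ?_
    rw [lintegral_const_mul]
    · rfl
    · exact (measurable_detCoeff_momentHessian K L j).ennreal_ofReal
  · exact fun j _ => (measurable_detCoeff_momentHessian K L j).ennreal_ofReal.const_mul _

/-- At `a = b = 1` the coefficients add up to the finite volume of `K + L`. -/
theorem volCoeff_ne_top {K L : Set (EuclideanSpace ℝ (Fin n))} (hK : IsCompact K)
    (hKc : Convex ℝ K) (hKi : (interior K).Nonempty) (hL : IsCompact L) (hLc : Convex ℝ L)
    (hLi : (interior L).Nonempty) {j : ℕ} (hj : j ≤ n) : volCoeff K L j ≠ ⊤ := by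
  have h := measure_smul_add_smul_eq_sum hK hKc hKi hL hLc hLi zero_le_one zero_le_one
    (by norm_num)
  have hfin : volume ((1 : ℝ) • K + (1 : ℝ) • L) ≠ ⊤ :=
    ((hK.smul (1 : ℝ)).add (hL.smul (1 : ℝ))).measure_lt_top.ne
  rw [h, ENNReal.sum_ne_top] at hfin
  simpa using hfin j (Finset.mem_range.2 (by omega))

end Hessian

/-! ### Identification of the coefficients with mixed volumes. -/

section MixedVolumes

open scoped Pointwise

variable {n : ℕ}

theorem vol_smul_add_smul {K L : ConvexBody (EuclideanSpace ℝ (Fin n))}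
    (hK : (interior (K : Set (EuclideanSpace ℝ (Fin n)))).Nonempty)
    (hL : (interior (L : Set (EuclideanSpace ℝ (Fin n)))).Nonempty) {a b : ℝ} (ha : 0 ≤ a)
    (hb : 0 ≤ b) (hab : 0 < a + b) :
    vol (a • K + b • L) =
      ∑ j ∈ Finset.range (n + 1), a ^ j * b ^ (n - j) * 
        (volCoeff (K : Set (EuclideanSpace ℝ (Fin n))) (L : Set (EuclideanSpace ℝ (Fin n))) j).toReal := by
  rw [vol, ConvexBody.coe_add, ConvexBody.coe_smul, ConvexBody.coe_smul, measureReal_def,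
    measure_smul_add_smul_eq_sum K.isCompact K.convex hK L.isCompact L.convex hL ha hb hab,
    ENNReal.toReal_sum]
  · refine Finset.sum_congr rfl fun j _ => ?_
    rw [ENNReal.toReal_mul, ENNReal.toReal_ofReal (by positivity)]
  · intro j hj
    exact ENNReal.mul_ne_top ENNReal.ofReal_ne_top (volCoeff_ne_top K.isCompact K.convex hK
      L.isCompact L.convex hL (by have := Finset.mem_range.1 hj; omega))

/-- A map to `Fin 2` amounts to the subset sent to `0`; grouping subsets by cardinality produces the
binomial coefficient. -/
theorem sum_prod_mul_card_filter (c : Fin 2 → ℝ) (w : ℕ → ℝ) :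
    ∑ f : Fin n → Fin 2, (∏ i, c (f i)) * w (Finset.univ.filter fun i => f i = 0).card =
      ∑ j ∈ Finset.range (n + 1), c 0 ^ j * c 1 ^ (n - j) * (n.choose j * w j) := by
  have h1 : ∑ f : Fin n → Fin 2, (∏ i, c (f i)) * w (Finset.univ.filter fun i => f i = 0).card =
      ∑ S : Finset (Fin n), c 0 ^ S.card * c 1 ^ (n - S.card) * w S.card := by
    refine Finset.sum_nbij' (fun f => Finset.univ.filter fun i => f i = 0)
      (fun S i => if i ∈ S then 0 else 1) (by simp) (by simp) ?_ ?_ ?_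
    · intro f _
      funext i
      rcases Fin.exists_fin_two.1 ⟨f i, rfl⟩ with h | h <;> simp [h]
    · intro S _
      ext i
      simp
    · intro f _
      congr 1
      have h2 : ∀ i, c (f i) = if f i = 0 then c 0 else c 1 := by
        intro i
        rcases Fin.exists_fin_two.1 ⟨f i, rfl⟩ with h | h <;> simp [h]
      simp only [h2]
      rw [Finset.prod_ite, Finset.prod_const, Finset.prod_const]
      congr 2
      rw [← Finset.compl_filter, Finset.card_compl, Fintype.card_fin]
  rw [h1, ← Finset.powerset_univ, Finset.sum_powerset, Finset.card_univ, Fintype.card_fin]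
  refine Finset.sum_congr rfl fun j _ => ?_
  rw [Finset.sum_congr rfl fun S hS => by rw [(Finset.mem_powersetCard.1 hS).2],
    Finset.sum_const, Finset.card_powersetCard, Finset.card_univ, Fintype.card_fin, nsmul_eq_mul]
  ring

theorem mixedVolumePair_eq {K L : ConvexBody (EuclideanSpace ℝ (Fin n))} (hn : n ≠ 0)
    (hK : (interior (K : Set (EuclideanSpace ℝ (Fin n)))).Nonempty)
    (hL : (interior (L : Set (EuclideanSpace ℝ (Fin n)))).Nonempty) {j : ℕ} (hj : j ≤ n) :
    mixedVolumePair K L j =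
      (volCoeff (K : Set (EuclideanSpace ℝ (Fin n))) (L : Set (EuclideanSpace ℝ (Fin n))) j).toReal /
        n.choose j := by
  set e : ℕ → ℝ := fun j =>
    (volCoeff (K : Set (EuclideanSpace ℝ (Fin n))) (L : Set (EuclideanSpace ℝ (Fin n))) j).toReal
  set w : ℕ → ℝ := fun j => e j / n.choose j
  -- The candidate coefficient depends only on how many indices select `K`, which makes it
  -- symmetric.
  have h := mixedVolume_eq_of_expansion ![K, L]
    (fun f => w (Finset.univ.filter fun i => f i = 0).card) ?_ ?_
    (fun i => if (i : ℕ) < j then 0 else 1)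
  · have h2 : mixedVolumePair K L j =
        mixedVolume fun i : Fin n => ![K, L] (if (i : ℕ) < j then 0 else 1) := by
      unfold mixedVolumePair
      congr 1
      funext i
      split_ifs <;> rfl
    rw [h2, h]
    have h3 : (Finset.univ.filter fun i : Fin n => (if (i : ℕ) < j then (0 : Fin 2) else 1) = 0).card
        = j := by
      simp [Fin.card_filter_val_lt, hj]
    rw [h3]
  · intro f σ
    have : (Finset.univ.filter fun i => (f ∘ σ) i = 0).card =
        (Finset.univ.filter fun i => f i = 0).card :=
      Finset.card_equiv σ (by simp)
    rw [this]
  · intro c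
    rw [sum_prod_mul_card_filter (fun i => (c i : ℝ)) w, Fin.sum_univ_two]
    have h4 : ∑ j ∈ Finset.range (n + 1),
        (c 0 : ℝ) ^ j * (c 1 : ℝ) ^ (n - j) * (n.choose j * w j) =
        ∑ j ∈ Finset.range (n + 1), (c 0 : ℝ) ^ j * (c 1 : ℝ) ^ (n - j) * e j := by
      refine Finset.sum_congr rfl fun i hi => ?_
      have : (n.choose i : ℝ) ≠ 0 := by
        exact_mod_cast (Nat.choose_pos (by have := Finset.mem_range.1 hi; omega)).ne'
      simp only [w]
      field_simp
    rw [h4]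
    change vol ((c 0 : ℝ) • K + (c 1 : ℝ) • L) = _
    -- The transport argument excludes `a = b = 0`. There the Minkowski sum is `{0}`, of volume zero
    -- as `n ≠ 0`, and every monomial vanishes.
    by_cases hc : 0 < (c 0 : ℝ) + c 1
    · exact vol_smul_add_smul hK hL (c 0).2 (c 1).2 hc
    · have h0 : (c 0 : ℝ) = 0 := by linarith [(c 0).coe_nonneg, (c 1).coe_nonneg]
      have h1 : (c 1 : ℝ) = 0 := by linarith [(c 0).coe_nonneg, (c 1).coe_nonneg]
      have : Nonempty (Fin n) := ⟨⟨0, Nat.pos_of_ne_zero hn⟩⟩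
      rw [h0, h1, vol, ConvexBody.coe_add, ConvexBody.coe_smul, ConvexBody.coe_smul,
        Set.zero_smul_set K.nonempty, Set.zero_smul_set L.nonempty,
        add_zero (0 : Set (EuclideanSpace ℝ (Fin n)))]
      rw [Finset.sum_eq_zero]
      · rw [measureReal_def, ← Set.singleton_zero, measure_singleton, ENNReal.toReal_zero]
      · intro i hi
        rcases Nat.eq_zero_or_pos i with h | h
        · subst h; simp [hn]
        · simp [h.ne']

end MixedVolumes

/-! ### Beta integrals with integer exponents. -/

section BetaIntegral

/-- Integration by parts moves one power from `1 - x` to `x`, hence induction on `q` with `p` free.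
-/
theorem integral_pow_mul_one_sub_pow (p q : ℕ) :
    ∫ x in (0 : ℝ)..1, x ^ p * (1 - x) ^ q = (p ! * q ! : ℝ) / (p + q + 1)! := by
  induction q generalizing p with
  | zero =>
    simp only [pow_zero, mul_one, integral_pow, add_zero, Nat.factorial_zero, Nat.cast_one,
      Nat.factorial_succ]
    have : (p ! : ℝ) ≠ 0 := by positivity
    push_cast
    field_simp
    simp
  | succ q ih =>
    have hd : ∀ x : ℝ, HasDerivAt (fun x : ℝ => x ^ (p + 1) * (1 - x) ^ (q + 1))
        ((p + 1) * (x ^ p * (1 - x) ^ (q + 1)) - (q + 1) * (x ^ (p + 1) * (1 - x) ^ q)) x := by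
      intro x
      have h1 : HasDerivAt (fun x : ℝ => 1 - x) (-1) x := by
        simpa using (hasDerivAt_id x).const_sub 1
      have h2 := (hasDerivAt_pow (p + 1) x).mul (h1.pow (q + 1))
      refine h2.congr_deriv ?_
      simp only [Pi.pow_apply, add_tsub_cancel_right]
      push_cast
      ring
    have h := intervalIntegral.integral_eq_sub_of_hasDerivAt (a := 0) (b := 1)
      (fun x _ => hd x) ((by fun_prop : Continuous _).intervalIntegrable _ _)
    rw [intervalIntegral.integral_sub ((by fun_prop : Continuous _).intervalIntegrable _ _)
      ((by fun_prop : Continuous _).intervalIntegrable _ _),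
      intervalIntegral.integral_const_mul, intervalIntegral.integral_const_mul, ih (p + 1)] at h
    simp only [sub_self, one_pow, sub_zero, ne_eq, Nat.add_eq_zero_iff, one_ne_zero,
      and_false, not_false_eq_true, zero_pow, mul_zero, mul_one] at h
    rw [show p + 1 + q + 1 = p + (q + 1) + 1 by ring] at h
    have h3 : ((p : ℝ) + 1) * ∫ x in (0 : ℝ)..1, x ^ p * (1 - x) ^ (q + 1) =
        (p + 1) * ((p ! * (q + 1)! : ℝ) / (p + (q + 1) + 1)!) := by
      rw [sub_eq_zero.1 h, Nat.factorial_succ p, Nat.factorial_succ q]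
      push_cast
      ring
    exact mul_left_cancel₀ (by positivity) h3

theorem lintegral_ofReal_pow_mul_one_sub_pow {c : ℝ} (hc : 0 ≤ c) (p q : ℕ) :
    ∫⁻ x in Set.Icc (0 : ℝ) 1, ENNReal.ofReal (c * (x ^ p * (1 - x) ^ q)) =
      ENNReal.ofReal (c * ((p ! * q ! : ℝ) / (p + q + 1)!)) := by
  rw [← ofReal_integral_eq_lintegral_ofReal, integral_Icc_eq_integral_Ioc,
    ← intervalIntegral.integral_of_le zero_le_one, intervalIntegral.integral_const_mul,
    integral_pow_mul_one_sub_pow]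
  · exact ContinuousOn.integrableOn_compact isCompact_Icc (by fun_prop)
  · refine (ae_restrict_iff' measurableSet_Icc).2 (Filter.Eventually.of_forall fun x hx => ?_)
    have h1 : 0 ≤ x := hx.1
    have h2 : 0 ≤ 1 - x := sub_nonneg.2 hx.2
    simp only [Pi.zero_apply]
    positivity

/-- The weight is chosen so that its tail is `(1 - g) ^ n`, the factor by which volume shrinks in a
fibre scaled by `1 - g`. -/
theorem lintegral_ofReal_mul_one_sub_pow {n : ℕ} (hn : n ≠ 0) {g : ℝ} (hg : g ≤ 1) :
    ∫⁻ s in Set.Icc g 1, ENNReal.ofReal (n * (1 - s) ^ (n - 1)) =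
      ENNReal.ofReal ((1 - g) ^ n) := by
  rw [← ofReal_integral_eq_lintegral_ofReal, integral_Icc_eq_integral_Ioc,
    ← intervalIntegral.integral_of_le hg]
  · congr 1
    have hd : ∀ x : ℝ, HasDerivAt (fun s : ℝ => -(1 - s) ^ n) (n * (1 - x) ^ (n - 1)) x := by
      intro x
      have h1 : HasDerivAt (fun x : ℝ => 1 - x) (-1) x := by
        simpa using (hasDerivAt_id x).const_sub 1
      refine (h1.pow n).neg.congr_deriv ?_
      ring
    rw [intervalIntegral.integral_eq_sub_of_hasDerivAt (fun x _ => hd x)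
      ((by fun_prop : Continuous _).intervalIntegrable _ _)]
    simp [hn]
  · exact ContinuousOn.integrableOn_compact isCompact_Icc (by fun_prop)
  · refine (ae_restrict_iff' measurableSet_Icc).2 (Filter.Eventually.of_forall fun x hx => ?_)
    have h2 : 0 ≤ 1 - x := sub_nonneg.2 hx.2
    simp only [Pi.zero_apply]
    positivity

end BetaIntegral

/-! ### The join, its lift, and the volume comparison between them. -/

section RogersShephard

open scoped Pointwise

variable {E : Type*} [NormedAddCommGroup E] [NormedSpace ℝ E]

/-- The union over `θ ∈ [0, 1]` of `{θ} × (θ (1 - l) K - (1 - θ) l K)`. -/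
def joinBody (K : Set E) (l : ℝ) : Set (ℝ × E) :=
  (fun z : ℝ × E × E => (z.1, (z.1 * (1 - l)) • z.2.1 - (l * (1 - z.1)) • z.2.2)) ''
    (Set.Icc 0 1 ×ˢ K ×ˢ K)

/-- A body over `joinBody K l`, whose fibre over the point `(l, 0)` is `l K`. -/
def liftBody (K : Set E) (l : ℝ) : Set ((ℝ × E) × E) :=
  (fun z : ℝ × E × E =>
    ((z.1, (z.1 * (1 - l)) • z.2.1 - (l * (1 - z.1)) • z.2.2), z.1 • z.2.1)) ''
    (Set.Icc 0 1 ×ˢ K ×ˢ K)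

theorem isCompact_joinBody {K : Set E} (hK : IsCompact K) (l : ℝ) : IsCompact (joinBody K l) :=
  (isCompact_Icc.prod (hK.prod hK)).image (by fun_prop)

theorem isCompact_liftBody {K : Set E} (hK : IsCompact K) (l : ℝ) : IsCompact (liftBody K l) :=
  (isCompact_Icc.prod (hK.prod hK)).image (by fun_prop)

/-- Fibres of the lift over points of a shrunken copy of the base contain shrunken copies of the
central fibre. -/
theorem liftBody_fibre_subset {K : Set E} (hKc : Convex ℝ K) {l s : ℝ} (hl : l ∈ Set.Icc (0 : ℝ) 1)
    (hs : s ∈ Set.Icc (0 : ℝ) 1) {p : ℝ × E} (hp : p ∈ joinBody K l) :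
    ∃ v : E, v +ᵥ (((1 - s) * l) • K) ⊆
      Prod.mk (AffineMap.homothety ((l, 0) : ℝ × E) s p) ⁻¹' liftBody K l := by
  obtain ⟨⟨θ, x, y⟩, ⟨hθ, hx, hy⟩, rfl⟩ := hp
  simp only at hθ hx hy
  have hs0 : 0 ≤ s := hs.1
  have hs1 : 0 ≤ 1 - s := sub_nonneg.2 hs.2
  have hl0 : 0 ≤ l := hl.1
  have hl1 : 0 ≤ 1 - l := sub_nonneg.2 hl.2
  have hθ0 : 0 ≤ θ := hθ.1
  have hθ1 : 0 ≤ 1 - θ := sub_nonneg.2 hθ.2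
  -- `θ • x` lies in the fibre over `p`, and the fibre over the shrunken point contains `(1 - s) •
  -- (l • K) + s • (θ • x)`.
  refine ⟨(s * θ) • x, ?_⟩
  rintro _ ⟨_, ⟨x₀, hx₀, rfl⟩, rfl⟩
  -- The new height is `(1 - s) l + s θ`. The central point uses `x₀` in both roles, so its middle
  -- coordinate is `0`; convexity of `K` merges each pair of multiples into one.
  have h1 : ((1 - s) * l) • x₀ + (s * θ) • x ∈ ((1 - s) * l + s * θ) • K := by
    rw [hKc.add_smul (by positivity) (by positivity)]
    exact Set.add_mem_add (Set.smul_mem_smul_set hx₀) (Set.smul_mem_smul_set hx)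
  have h2 : ((1 - s) * (1 - l)) • x₀ + (s * (1 - θ)) • y ∈
      ((1 - s) * (1 - l) + s * (1 - θ)) • K := by
    rw [hKc.add_smul (by positivity) (by positivity)]
    exact Set.add_mem_add (Set.smul_mem_smul_set hx₀) (Set.smul_mem_smul_set hy)
  obtain ⟨x', hx', hxe⟩ := h1
  obtain ⟨y', hy', hye⟩ := h2
  simp only at hxe hye
  refine ⟨((1 - s) * l + s * θ, x', y'), ⟨⟨by positivity, ?_⟩, hx', hy'⟩, ?_⟩
  · nlinarith [mul_nonneg hs1 hl1, mul_nonneg hs0 hθ1]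
  · have e1 : (1 - ((1 - s) * l + s * θ)) = (1 - s) * (1 - l) + s * (1 - θ) := by ring
    simp only [AffineMap.homothety_apply, vsub_eq_sub, vadd_eq_add, e1]
    refine Prod.ext (Prod.ext ?_ ?_) ?_
    · simp; ring
    · simp only [Prod.snd_add, Prod.smul_snd, Prod.snd_sub, sub_zero, add_zero]
      rw [mul_comm _ (1 - l), mul_smul, mul_smul l, hxe, hye]
      module
    · simp only
      rw [hxe, add_comm]

variable [FiniteDimensional ℝ E] [MeasureSpace E] [BorelSpace E]
  [(volume : Measure E).IsAddHaarMeasure]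

theorem measure_liftBody_fibre_ge {K : Set E} (hKc : Convex ℝ K) {l s : ℝ}
    (hl : l ∈ Set.Icc (0 : ℝ) 1) (hs : s ∈ Set.Icc (0 : ℝ) 1) {p : ℝ × E}
    (hp : p ∈ joinBody K l) :
    ENNReal.ofReal ((1 - s) ^ Module.finrank ℝ E) *
        (ENNReal.ofReal (l ^ Module.finrank ℝ E) * volume K) ≤
      volume (Prod.mk (AffineMap.homothety ((l, 0) : ℝ × E) s p) ⁻¹' liftBody K l) := by
  obtain ⟨v, hv⟩ := liftBody_fibre_subset hKc hl hs hp
  refine le_trans (le_of_eq ?_) (measure_mono hv)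
  have h1 : 0 ≤ 1 - s := sub_nonneg.2 hs.2
  have h2 : 0 ≤ l := hl.1
  rw [measure_vadd, Measure.addHaar_smul, abs_of_nonneg (by positivity), mul_pow,
    ENNReal.ofReal_mul (by positivity), mul_assoc]

/-- In a point `(θ, W, X)` of the lift, `X = θ x` lies in `θK` and `W = (1-l) X - l (1-θ) y` lies in
a translate of `-l(1-θ)K`. Fubini leaves a Beta integral in `θ`. -/
theorem measure_liftBody_le {K : Set E} (hK : IsCompact K) {l : ℝ} (hl : 0 ≤ l) :
    volume (liftBody K l) ≤ ENNReal.ofReal (l ^ Module.finrank ℝ E *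
      (((Module.finrank ℝ E)! * (Module.finrank ℝ E)! : ℝ) /
        (Module.finrank ℝ E + Module.finrank ℝ E + 1)!)) * (volume K * volume K) := by
  set n := Module.finrank ℝ E
  have hQ := (isCompact_liftBody hK l).measurableSet
  have h1 : volume (liftBody K l) = ∫⁻ θ : ℝ, (volume : Measure (E × E))
      ((fun z : E × E => ((θ, z.1), z.2)) ⁻¹' liftBody K l) := by
    have hmeas : Measurable fun p : ℝ × E => volume (Prod.mk p ⁻¹' liftBody K l) :=
      measurable_measure_prodMk_left hQ
    rw [Measure.volume_eq_prod, Measure.prod_apply hQ, Measure.volume_eq_prod ℝ E,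
      lintegral_prod _ hmeas.aemeasurable]
    refine lintegral_congr fun θ => ?_
    rw [Measure.volume_eq_prod, Measure.prod_apply (hQ.preimage (by fun_prop))]
    rfl
  have h2 : ∀ θ : ℝ, (volume : Measure (E × E))
      ((fun z : E × E => ((θ, z.1), z.2)) ⁻¹' liftBody K l) ≤
      (Set.Icc (0 : ℝ) 1).indicator
        (fun θ => ENNReal.ofReal (l ^ n * (θ ^ n * (1 - θ) ^ n)) * (volume K * volume K)) θ := by
    intro θ
    by_cases hθ : θ ∈ Set.Icc (0 : ℝ) 1
    · rw [Set.indicator_of_mem hθ]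
      have hθ0 : 0 ≤ θ := hθ.1
      have hθ1 : 0 ≤ 1 - θ := sub_nonneg.2 hθ.2
      rw [Measure.volume_eq_prod, Measure.prod_apply_symm (hQ.preimage (by fun_prop))]
      calc ∫⁻ X : E, volume ((fun W : E => (W, X)) ⁻¹'
              ((fun z : E × E => ((θ, z.1), z.2)) ⁻¹' liftBody K l))
          ≤ ∫⁻ X : E, (θ • K).indicator
              (fun _ => ENNReal.ofReal ((l * (1 - θ)) ^ n) * volume K) X := by
            refine lintegral_mono fun X => ?_
            by_cases hX : X ∈ θ • K
            · rw [Set.indicator_of_mem hX]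
              have hsub : ((fun W : E => (W, X)) ⁻¹'
                  ((fun z : E × E => ((θ, z.1), z.2)) ⁻¹' liftBody K l)) ⊆
                  ((1 - l) • X) +ᵥ ((-(l * (1 - θ))) • K) := by
                rintro W ⟨⟨θ', x, y⟩, ⟨_, _, hy⟩, he⟩
                simp only [Prod.mk.injEq] at he
                obtain ⟨⟨rfl, rfl⟩, rfl⟩ := he
                refine ⟨(-(l * (1 - θ'))) • y, Set.smul_mem_smul_set hy, ?_⟩
                simp only [vadd_eq_add]
                module
              refine (measure_mono hsub).trans (le_of_eq ?_)
              rw [measure_vadd, Measure.addHaar_smul, abs_pow, abs_neg,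
                abs_of_nonneg (by positivity)]
            · rw [Set.indicator_of_notMem hX]
              refine le_of_eq ?_
              convert measure_empty (μ := (volume : Measure E))
              rw [Set.eq_empty_iff_forall_notMem]
              rintro W ⟨⟨θ', x, y⟩, ⟨_, hx, _⟩, he⟩
              simp only [Prod.mk.injEq] at he
              obtain ⟨⟨rfl, rfl⟩, rfl⟩ := he
              exact hX (Set.smul_mem_smul_set hx)
        _ = ENNReal.ofReal (l ^ n * (θ ^ n * (1 - θ) ^ n)) * (volume K * volume K) := by
            rw [lintegral_indicator_const (hK.smul θ).measurableSet, Measure.addHaar_smul,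
              abs_of_nonneg (by positivity), mul_mul_mul_comm, ← ENNReal.ofReal_mul (by positivity)]
            congr 2
            change (l * (1 - θ)) ^ n * θ ^ n = _
            rw [mul_pow]
            ring
    · rw [Set.indicator_of_notMem hθ]
      refine le_of_eq ?_
      convert measure_empty (μ := (volume : Measure (E × E)))
      rw [Set.eq_empty_iff_forall_notMem]
      rintro W ⟨⟨θ', x, y⟩, ⟨hθ', _, _⟩, he⟩
      simp only [Prod.mk.injEq] at he
      obtain ⟨⟨rfl, _⟩, _⟩ := he
      exact hθ hθ'
  rw [h1]
  refine (lintegral_mono h2).trans (le_of_eq ?_)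
  rw [lintegral_indicator measurableSet_Icc, lintegral_mul_const _ (by fun_prop),
    lintegral_ofReal_pow_mul_one_sub_pow (by positivity)]

/-- A Rogers–Shephard type inequality between the volumes of the base and of the lift. -/
theorem measure_joinBody_le_liftBody {K : Set E} (hK : IsCompact K) (hKc : Convex ℝ K)
    {l : ℝ} (hl : l ∈ Set.Icc (0 : ℝ) 1) (hn : Module.finrank ℝ E ≠ 0) :
    ENNReal.ofReal ((Module.finrank ℝ E : ℝ) *
        ((((Module.finrank ℝ E + 1)! : ℝ) * (Module.finrank ℝ E - 1)!) /
          (Module.finrank ℝ E + 1 + (Module.finrank ℝ E - 1) + 1)!)) * volume (joinBody K l) *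
        (ENNReal.ofReal (l ^ Module.finrank ℝ E) * volume K) ≤
      volume (liftBody K l) := by
  set n := Module.finrank ℝ E
  set c := ENNReal.ofReal (l ^ n) * volume K with hc
  set o : ℝ × E := (l, 0)
  -- Pairs `(s, p)` with `p` in the copy of the base shrunk by `s` towards `o`. Integrating the
  -- weight `n (1 - s)^(n-1)` over `R` slice by slice in `s` gives the volume of the base times the
  -- stated Beta constant; integrating in `s` first gives the fibre bound.
  set R : Set (ℝ × (ℝ × E)) :=
    (fun z : ℝ × (ℝ × E) => (z.1, AffineMap.homothety o z.1 z.2)) ''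
      (Set.Icc 0 1 ×ˢ joinBody K l) with hR
  have hRc : IsCompact R :=
    (isCompact_Icc.prod (isCompact_joinBody hK l)).image (by
      simp only [AffineMap.homothety_apply, vsub_eq_sub, vadd_eq_add]; fun_prop)
  have hRm := hRc.measurableSet
  have hQ := (isCompact_liftBody hK l).measurableSet
  have hslice : ∀ s ∈ Set.Icc (0 : ℝ) 1,
      Prod.mk s ⁻¹' R = AffineMap.homothety o s '' joinBody K l := by
    intro s hs
    ext p
    constructor
    · rintro ⟨⟨s', q⟩, ⟨_, hq⟩, he⟩
      simp only [Prod.mk.injEq] at he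
      obtain ⟨rfl, rfl⟩ := he
      exact ⟨q, hq, rfl⟩
    · rintro ⟨q, hq, rfl⟩
      exact ⟨(s, q), ⟨hs, hq⟩, rfl⟩
  have hpoint : ∀ p : ℝ × E,
      (∫⁻ s : ℝ, R.indicator (fun z => ENNReal.ofReal (n * (1 - z.1) ^ (n - 1))) (s, p)) * c ≤
        volume (Prod.mk p ⁻¹' liftBody K l) := by
    intro p
    set S : Set ℝ := (fun s => (s, p)) ⁻¹' R with hS
    have hS01 : S ⊆ Set.Icc 0 1 := by
      rintro s ⟨⟨s', q⟩, ⟨hs', _⟩, he⟩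
      simp only [Prod.mk.injEq] at he
      obtain ⟨rfl, -⟩ := he
      exact hs'
    rcases S.eq_empty_or_nonempty with hSe | hSne
    · have : ∀ s : ℝ, R.indicator
          (fun z => ENNReal.ofReal (n * (1 - z.1) ^ (n - 1))) (s, p) = 0 := fun s =>
        Set.indicator_of_notMem (fun h => by
          have : s ∈ S := h
          rw [hSe] at this
          exact this) _
      rw [lintegral_congr this, lintegral_zero, zero_mul]
      exact zero_le
    · have hSc : IsCompact S :=
        isCompact_Icc.of_isClosed_subset (hRc.isClosed.preimage (by fun_prop)) hS01
      -- `g` is the smallest shrinking factor whose copy of the base reaches `p`. Only `S ⊆ [g, 1]`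
      -- is needed, and the fibre estimate at `s = g` matches the tail of the weight.
      obtain ⟨g, hgS, hg⟩ := hSc.exists_isLeast hSne
      have hle : (∫⁻ s : ℝ, R.indicator
          (fun z => ENNReal.ofReal (n * (1 - z.1) ^ (n - 1))) (s, p)) ≤
          ENNReal.ofReal ((1 - g) ^ n) := by
        rw [← lintegral_ofReal_mul_one_sub_pow hn (hS01 hgS).2,
          ← lintegral_indicator measurableSet_Icc]
        refine lintegral_mono fun s => ?_
        by_cases hs : (s, p) ∈ R
        · rw [Set.indicator_of_mem hs, Set.indicator_of_mem]
          exact ⟨hg hs, (hS01 hs).2⟩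
        · rw [Set.indicator_of_notMem hs]
          exact zero_le
      obtain ⟨⟨s', q⟩, ⟨hs', hq⟩, he⟩ := hgS
      simp only [Prod.mk.injEq] at he
      obtain ⟨rfl, rfl⟩ := he
      exact (mul_le_mul_left hle c).trans (measure_liftBody_fibre_ge hKc hl hs' hq)
  have : (volume : Measure (ℝ × E)).IsAddHaarMeasure := by
    rw [Measure.volume_eq_prod]; infer_instance
  have hfin : Module.finrank ℝ (ℝ × E) = n + 1 := by
    rw [Module.finrank_prod, Module.finrank_self, add_comm]
  have hind : Measurable (R.indicator
      (fun z : ℝ × (ℝ × E) => ENNReal.ofReal (n * (1 - z.1) ^ (n - 1)))) :=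
    Measurable.indicator (by fun_prop) hRm
  calc ENNReal.ofReal ((n : ℝ) * ((((n + 1)! : ℝ) * (n - 1)!) / (n + 1 + (n - 1) + 1)!)) *
        volume (joinBody K l) * c
      = (∫⁻ s in Set.Icc (0 : ℝ) 1, ENNReal.ofReal (n * (1 - s) ^ (n - 1)) *
          volume (Prod.mk s ⁻¹' R)) * c := by
        rw [← lintegral_ofReal_pow_mul_one_sub_pow (Nat.cast_nonneg n),
          ← lintegral_mul_const _ (by fun_prop)]
        congr 1
        refine setLIntegral_congr_fun measurableSet_Icc fun s hs => ?_
        have hs0 : 0 ≤ s := hs.1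
        have hs1 : 0 ≤ 1 - s := sub_nonneg.2 hs.2
        rw [hslice s hs, Measure.addHaar_image_homothety, hfin, abs_of_nonneg (by positivity),
          show (n : ℝ) * (s ^ (n + 1) * (1 - s) ^ (n - 1)) =
            n * (1 - s) ^ (n - 1) * s ^ (n + 1) by ring,
          ENNReal.ofReal_mul (by positivity), mul_assoc]
    _ ≤ (∫⁻ s : ℝ, ∫⁻ p : ℝ × E,
          R.indicator (fun z => ENNReal.ofReal (n * (1 - z.1) ^ (n - 1))) (s, p)) * c := by
        refine mul_le_mul_left ((setLIntegral_le_lintegral _ _).trans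
          (lintegral_mono fun s => le_of_eq ?_)) c
        have : ∀ p : ℝ × E, R.indicator
            (fun z => ENNReal.ofReal (n * (1 - z.1) ^ (n - 1))) (s, p) =
            (Prod.mk s ⁻¹' R).indicator (fun _ => ENNReal.ofReal (n * (1 - s) ^ (n - 1))) p :=
          fun p => rfl
        simp only [this]
        rw [lintegral_indicator_const (hRm.preimage (by fun_prop))]
    _ = (∫⁻ p : ℝ × E, ∫⁻ s : ℝ,
          R.indicator (fun z => ENNReal.ofReal (n * (1 - z.1) ^ (n - 1))) (s, p)) * c := by
        rw [lintegral_lintegral_swap (f := fun s p => R.indicator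
          (fun z => ENNReal.ofReal (n * (1 - z.1) ^ (n - 1))) (s, p)) hind.aemeasurable]
    _ = ∫⁻ p : ℝ × E, (∫⁻ s : ℝ,
          R.indicator (fun z => ENNReal.ofReal (n * (1 - z.1) ^ (n - 1))) (s, p)) * c := by
        rw [lintegral_mul_const _ hind.lintegral_prod_left']
    _ ≤ ∫⁻ p : ℝ × E, volume (Prod.mk p ⁻¹' liftBody K l) := lintegral_mono hpoint
    _ = volume (liftBody K l) := by
        rw [Measure.volume_eq_prod (ℝ × E) E, Measure.prod_apply hQ]

/-- The upper and lower bounds for the lift share the factor `l^n vol K` and a Beta constant; `0 <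
l` makes this factor cancellable, and the two Beta constants differ exactly by `n + 1`. -/
theorem measure_joinBody_le {K : Set E} (hK : IsCompact K) (hKc : Convex ℝ K)
    (hK0 : volume K ≠ 0) {l : ℝ} (hl : l ∈ Set.Ioo (0 : ℝ) 1) (hn : Module.finrank ℝ E ≠ 0) :
    ENNReal.ofReal (Module.finrank ℝ E + 1) * volume (joinBody K l) ≤ volume K := by
  have h := (measure_joinBody_le_liftBody hK hKc (Set.Ioo_subset_Icc_self hl) hn).trans
    (measure_liftBody_le hK hl.1.le)
  set n := Module.finrank ℝ E
  set B : ℝ := (n ! * n ! : ℝ) / (n + n + 1)! with hB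
  have hBpos : 0 < B := by positivity
  have hlpos : 0 < l ^ n := pow_pos hl.1 n
  have h1 : (n : ℝ) * ((((n + 1)! : ℝ) * (n - 1)!) / (n + 1 + (n - 1) + 1)!) = B * (n + 1) := by
    clear_value n
    obtain ⟨m, rfl⟩ := Nat.exists_eq_succ_of_ne_zero hn
    rw [hB, show m.succ + 1 + (m.succ - 1) + 1 = m.succ + m.succ + 1 by omega,
      Nat.factorial_succ (m.succ), Nat.succ_sub_one, Nat.factorial_succ m]
    push_cast
    ring
  rw [h1, ENNReal.ofReal_mul hBpos.le, ENNReal.ofReal_mul hlpos.le] at h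
  have hKt : volume K ≠ ⊤ := hK.measure_lt_top.ne
  set d := ENNReal.ofReal B * (ENNReal.ofReal (l ^ n) * volume K)
  have hd0 : d ≠ 0 := by
    simp only [d, ne_eq, mul_eq_zero, ENNReal.ofReal_eq_zero, not_or, not_le]
    exact ⟨hBpos, hlpos, hK0⟩
  have hdt : d ≠ ⊤ := ENNReal.mul_ne_top ENNReal.ofReal_ne_top
    (ENNReal.mul_ne_top ENNReal.ofReal_ne_top hKt)
  rw [← ENNReal.mul_le_mul_iff_right hd0 hdt]
  calc d * (ENNReal.ofReal (n + 1) * volume (joinBody K l)) = _ := by ring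
    _ ≤ _ := h
    _ = d * volume K := by ring

/-- Integrated over `θ`, the volumes of `θ (1 - l) K - (1 - θ) l K` are at most
`vol K / (n + 1)`. -/
theorem lintegral_measure_smul_sub_smul_le {K : Set E} (hK : IsCompact K) (hKc : Convex ℝ K)
    (hK0 : volume K ≠ 0) {l : ℝ} (hl : l ∈ Set.Ioo (0 : ℝ) 1) (hn : Module.finrank ℝ E ≠ 0) :
    ENNReal.ofReal (Module.finrank ℝ E + 1) * ∫⁻ θ in Set.Icc (0 : ℝ) 1,
      volume ((θ * (1 - l)) • K + (l * (1 - θ)) • ((-1 : ℝ) • K)) ≤ volume K := by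
  refine le_trans (mul_le_mul_right ?_ _) (measure_joinBody_le hK hKc hK0 hl hn)
  rw [Measure.volume_eq_prod, Measure.prod_apply (isCompact_joinBody hK l).measurableSet]
  refine le_trans (setLIntegral_mono' measurableSet_Icc fun θ hθ => measure_mono ?_)
    (setLIntegral_le_lintegral _ _)
  rintro _ ⟨_, ⟨x, hx, rfl⟩, _, ⟨_, ⟨y, hy, rfl⟩, rfl⟩, rfl⟩
  refine ⟨(θ, x, y), ⟨hθ, hx, hy⟩, ?_⟩
  simp only [Prod.mk.injEq, true_and]
  module

end RogersShephard

/-! ### Inequalities for the mixed volumes of `K` and `-K`. -/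

section Reflection

open scoped Pointwise

variable {n : ℕ} {K : ConvexBody (EuclideanSpace ℝ (Fin n))}

theorem interior_reflect_nonempty
    (hK : (interior (K : Set (EuclideanSpace ℝ (Fin n)))).Nonempty) :
    (interior (reflect K : Set (EuclideanSpace ℝ (Fin n)))).Nonempty := by
  rw [reflect, ConvexBody.coe_smul, interior_smul₀ (by norm_num)]
  exact hK.smul_set

theorem vol_reflect (K : ConvexBody (EuclideanSpace ℝ (Fin n))) : vol (reflect K) = vol K := by
  rw [vol, reflect, ConvexBody.coe_smul, measureReal_def, Measure.addHaar_smul]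
  simp [vol, measureReal_def]

theorem vol_smul_add_smul_eq_sum_mixedVolumePair {L : ConvexBody (EuclideanSpace ℝ (Fin n))}
    (hn : n ≠ 0) (hK : (interior (K : Set (EuclideanSpace ℝ (Fin n)))).Nonempty)
    (hL : (interior (L : Set (EuclideanSpace ℝ (Fin n)))).Nonempty) {a b : ℝ} (ha : 0 ≤ a)
    (hb : 0 ≤ b) (hab : 0 < a + b) :
    vol (a • K + b • L) = ∑ j ∈ Finset.range (n + 1),
      a ^ j * b ^ (n - j) * (n.choose j * mixedVolumePair K L j) := by
  rw [vol_smul_add_smul hK hL ha hb hab]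
  refine Finset.sum_congr rfl fun j hj => ?_
  have hjn : j ≤ n := by have := Finset.mem_range.1 hj; omega
  have : (n.choose j : ℝ) ≠ 0 := by exact_mod_cast (Nat.choose_pos hjn).ne'
  rw [mixedVolumePair_eq hn hK hL hjn, mul_div_cancel₀ _ this]

theorem mixedVolumePair_nonneg {L : ConvexBody (EuclideanSpace ℝ (Fin n))}
    (hn : n ≠ 0) (hK : (interior (K : Set (EuclideanSpace ℝ (Fin n)))).Nonempty)
    (hL : (interior (L : Set (EuclideanSpace ℝ (Fin n)))).Nonempty) {j : ℕ} (hj : j ≤ n) :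
    0 ≤ mixedVolumePair K L j := by
  rw [mixedVolumePair_eq hn hK hL hj]
  positivity

theorem mixedVolumePair_self {L : ConvexBody (EuclideanSpace ℝ (Fin n))}
    (hn : n ≠ 0) (hK : (interior (K : Set (EuclideanSpace ℝ (Fin n)))).Nonempty)
    (hL : (interior (L : Set (EuclideanSpace ℝ (Fin n)))).Nonempty) :
    mixedVolumePair K L n = vol K := by
  have h := vol_smul_add_smul_eq_sum_mixedVolumePair hn hK hL zero_le_one le_rfl (by norm_num)
  rw [Finset.sum_range_succ, Finset.sum_eq_zero] at h
  · have h2 : vol ((1 : ℝ) • K + (0 : ℝ) • L) = vol K := by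
      rw [vol, ConvexBody.coe_add, ConvexBody.coe_smul, ConvexBody.coe_smul,
        Set.zero_smul_set L.nonempty, one_smul, add_zero, vol]
    rw [h2] at h
    simpa using h.symm
  · intro j hj
    have := Finset.mem_range.1 hj
    simp [show n - j ≠ 0 by omega]

theorem mixedVolumePair_zero {L : ConvexBody (EuclideanSpace ℝ (Fin n))}
    (hn : n ≠ 0) (hK : (interior (K : Set (EuclideanSpace ℝ (Fin n)))).Nonempty)
    (hL : (interior (L : Set (EuclideanSpace ℝ (Fin n)))).Nonempty) :
    mixedVolumePair K L 0 = vol L := by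
  have h := vol_smul_add_smul_eq_sum_mixedVolumePair hn hK hL le_rfl zero_le_one (by norm_num)
  rw [Finset.sum_range_succ', Finset.sum_eq_zero] at h
  · have h2 : vol ((0 : ℝ) • K + (1 : ℝ) • L) = vol L := by
      rw [vol, ConvexBody.coe_add, ConvexBody.coe_smul, ConvexBody.coe_smul,
        Set.zero_smul_set K.nonempty, one_smul, zero_add, vol]
    rw [h2] at h
    simpa using h.symm
  · intro j hj
    simp

theorem choose_mul_factorial_div {j : ℕ} (hj : j ≤ n) :
    (n.choose j : ℝ) * ((j ! * (n - j)! : ℝ) / (j + (n - j) + 1)!) = 1 / (n + 1) := by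
  rw [Nat.add_sub_cancel' hj, Nat.factorial_succ, ← Nat.choose_mul_factorial_mul_factorial hj]
  have h1 : (n.choose j : ℝ) ≠ 0 := by exact_mod_cast (Nat.choose_pos hj).ne'
  have h2 : (j ! : ℝ) ≠ 0 := by positivity
  have h3 : ((n - j)! : ℝ) ≠ 0 := by positivity
  push_cast
  field_simp

/-- Expand the slice volumes of the join by Minkowski's polynomial and integrate over the height
`θ`: the Beta integral cancels the binomial coefficient up to `1 / (n + 1)`, which the factor `n +
1` absorbs. -/
theorem sum_mixedVolumePair_reflect_le (hn : n ≠ 0)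
    (hK : (interior (K : Set (EuclideanSpace ℝ (Fin n)))).Nonempty) {l : ℝ}
    (hl : l ∈ Set.Ioo (0 : ℝ) 1) :
    ∑ j ∈ Finset.range (n + 1),
      (1 - l) ^ j * l ^ (n - j) * mixedVolumePair K (reflect K) j ≤ vol K := by
  have hpos : volume (K : Set (EuclideanSpace ℝ (Fin n))) ≠ 0 :=
    ((isOpen_interior.measure_pos volume hK).trans_le (measure_mono interior_subset)).ne'
  have hL := interior_reflect_nonempty hK
  have h := lintegral_measure_smul_sub_smul_le K.isCompact K.convex hpos hl
    (by rwa [finrank_euclideanSpace_fin])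
  rw [finrank_euclideanSpace_fin] at h
  set V := fun j => mixedVolumePair K (reflect K) j
  have hl0 : 0 < l := hl.1
  have hl1 : 0 < 1 - l := sub_pos.2 hl.2
  have hVnn : ∀ j ∈ Finset.range (n + 1), 0 ≤ V j := fun j hj =>
    mixedVolumePair_nonneg hn hK hL (by have := Finset.mem_range.1 hj; omega)
  have hcnn : ∀ j ∈ Finset.range (n + 1),
      0 ≤ (1 - l) ^ j * l ^ (n - j) * (n.choose j * V j) := fun j hj => by
    have := hVnn j hj
    positivity
  have hint : ∫⁻ θ in Set.Icc (0 : ℝ) 1, volume ((θ * (1 - l)) • (K : Set (EuclideanSpace ℝ (Fin n)))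
      + (l * (1 - θ)) • ((-1 : ℝ) • (K : Set (EuclideanSpace ℝ (Fin n))))) =
      ∑ j ∈ Finset.range (n + 1), ENNReal.ofReal
        ((1 - l) ^ j * l ^ (n - j) * (n.choose j * V j) *
          ((j ! * (n - j)! : ℝ) / (j + (n - j) + 1)!)) := by
    have h1 : ∀ θ ∈ Set.Icc (0 : ℝ) 1, volume ((θ * (1 - l)) • (K : Set (EuclideanSpace ℝ (Fin n)))
        + (l * (1 - θ)) • ((-1 : ℝ) • (K : Set (EuclideanSpace ℝ (Fin n))))) =
        ∑ j ∈ Finset.range (n + 1), ENNReal.ofReal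
          ((1 - l) ^ j * l ^ (n - j) * (n.choose j * V j) * (θ ^ j * (1 - θ) ^ (n - j))) := by
      intro θ hθ
      have hθ0 : 0 ≤ θ := hθ.1
      have hθ1 : 0 ≤ 1 - θ := sub_nonneg.2 hθ.2
      have hab : 0 < θ * (1 - l) + l * (1 - θ) := by
        rcases hθ0.lt_or_eq with h0 | h0
        · have := mul_pos h0 hl1
          have := mul_nonneg hl0.le hθ1
          linarith
        · rw [← h0]; simpa using hl0
      have h2 := vol_smul_add_smul_eq_sum_mixedVolumePair hn hK hL
        (mul_nonneg hθ0 hl1.le) (mul_nonneg hl0.le hθ1) hab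
      rw [← ENNReal.ofReal_sum_of_nonneg fun j hj =>
        mul_nonneg (hcnn j hj) (by positivity)]
      rw [vol, reflect, ConvexBody.coe_add, ConvexBody.coe_smul, ConvexBody.coe_smul,
        ConvexBody.coe_smul] at h2
      rw [← ofReal_measureReal
        (h := ((K.isCompact.smul _).add ((K.isCompact.smul _).smul _)).measure_lt_top.ne), h2]
      congr 1
      refine Finset.sum_congr rfl fun j _ => ?_
      rw [mul_pow, mul_pow]
      simp only [V, reflect]
      ring
    rw [setLIntegral_congr_fun measurableSet_Icc h1, lintegral_finsetSum _ fun j _ => by fun_prop]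
    exact Finset.sum_congr rfl fun j hj => lintegral_ofReal_pow_mul_one_sub_pow (hcnn j hj) _ _
  rw [hint, ← ENNReal.ofReal_sum_of_nonneg fun j hj => mul_nonneg (hcnn j hj) (by positivity),
    ← ENNReal.ofReal_mul (by positivity),
    ← ofReal_measureReal (h := K.isCompact.measure_lt_top.ne),
    ENNReal.ofReal_le_ofReal_iff measureReal_nonneg] at h
  refine le_trans (le_of_eq ?_) h
  rw [Finset.mul_sum]
  refine Finset.sum_congr rfl fun j hj => ?_
  have hjn : j ≤ n := by have := Finset.mem_range.1 hj; omega
  have h3 := choose_mul_factorial_div hjn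
  have h4 : ((n : ℝ) + 1) * (1 / (n + 1)) = 1 := by field_simp
  calc (1 - l) ^ j * l ^ (n - j) * V j
      = (1 - l) ^ j * l ^ (n - j) * V j * (((n : ℝ) + 1) * (1 / (n + 1))) := by rw [h4, mul_one]
    _ = _ := by rw [← h3]; ring

/-- Averaging over `l ∈ (0, 1)` replaces each weight `(1-l)^j l^(n-j)` by `1 / ((n+1) * n.choose
j)`. -/
theorem sum_mixedVolumePair_reflect_div_choose_le (hn : n ≠ 0)
    (hK : (interior (K : Set (EuclideanSpace ℝ (Fin n)))).Nonempty) :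
    ∑ j ∈ Finset.range (n + 1), mixedVolumePair K (reflect K) j / n.choose j ≤
      (n + 1) * vol K := by
  have h : ∫ l in (0 : ℝ)..1, ∑ j ∈ Finset.range (n + 1),
      (1 - l) ^ j * l ^ (n - j) * mixedVolumePair K (reflect K) j ≤ ∫ _l in (0 : ℝ)..1, vol K :=
    intervalIntegral.integral_mono_on_of_le_Ioo zero_le_one
      ((by fun_prop : Continuous _).intervalIntegrable _ _)
      ((by fun_prop : Continuous _).intervalIntegrable _ _)
      fun l hl => sum_mixedVolumePair_reflect_le hn hK hl
  rw [intervalIntegral.integral_finsetSum fun j _ =>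
    (by fun_prop : Continuous _).intervalIntegrable _ _] at h
  have h1 : ∀ j ∈ Finset.range (n + 1), ∫ l in (0 : ℝ)..1,
      (1 - l) ^ j * l ^ (n - j) * mixedVolumePair K (reflect K) j =
      (1 / (n + 1)) * (mixedVolumePair K (reflect K) j / n.choose j) := by
    intro j hj
    have hjn : j ≤ n := by have := Finset.mem_range.1 hj; omega
    have hc : (n.choose j : ℝ) ≠ 0 := by exact_mod_cast (Nat.choose_pos hjn).ne'
    rw [intervalIntegral.integral_mul_const]
    simp only [mul_comm ((1 - _ : ℝ) ^ j)]
    rw [integral_pow_mul_one_sub_pow, ← choose_mul_factorial_div hjn, add_comm (n - j) j]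
    field_simp
  rw [Finset.sum_congr rfl h1, ← Finset.mul_sum, intervalIntegral.integral_const] at h
  have hn1 : (0 : ℝ) < n + 1 := by positivity
  rw [one_div, inv_mul_le_iff₀ hn1] at h
  simpa using h

end Reflection

end Godbersen

/-! ### The counting argument. -/

theorem mainTheorem6 (n k : ℕ) (hk : k < n) (K : ConvexBody (EuclideanSpace ℝ (Fin n)))
    (hK : (interior (K : Set (EuclideanSpace ℝ (Fin n)))).Nonempty)
    (hvol : Godbersen.vol K = 1) :
    k ≤ (Finset.filter
      (fun j : ℕ => Godbersen.mixedVolumePair K (Godbersen.reflect K) j ≤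
        ((n : ℝ) - 1) / ((n : ℝ) - (k : ℝ)) * (n.choose j : ℝ))
      (Finset.Icc 1 (n - 1))).card := by
  have hn : n ≠ 0 := by omega
  have hL := Godbersen.interior_reflect_nonempty hK
  by_contra! hlt
  have hk0 : 0 < k := by omega
  have hnk : (0 : ℝ) < (n : ℝ) - k := sub_pos.2 (by exact_mod_cast hk)
  set V := fun j => Godbersen.mixedVolumePair K (Godbersen.reflect K) j with hV
  have hsum := Godbersen.sum_mixedVolumePair_reflect_div_choose_le hn hK
  -- The end terms `j = 0` and `j = n` are `vol (-K)` and `vol K`, both `1`, so they use up `2` of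
  -- the total `n + 1`.
  have hmid : ∑ j ∈ Finset.Icc 1 (n - 1), V j / n.choose j ≤ (n : ℝ) - 1 := by
    obtain ⟨m, rfl⟩ := Nat.exists_eq_succ_of_ne_zero hn
    have hIcc : Finset.Icc 1 (m.succ - 1) = Finset.Ico 1 (m + 1) := by ext; simp
    rw [Finset.sum_range_succ, Finset.range_eq_Ico,
      Finset.sum_eq_sum_Ico_succ_bot (Nat.succ_pos m), hvol,
      Godbersen.mixedVolumePair_self hn hK hL, Godbersen.mixedVolumePair_zero hn hK hL,
      Godbersen.vol_reflect, hvol] at hsum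
    rw [hIcc]
    simp only [Nat.choose_zero_right, Nat.choose_self, Nat.cast_one, div_one, zero_add,
      mul_one, Nat.succ_eq_add_one] at hsum ⊢
    linarith
  set P : ℕ → Prop := fun j => V j ≤ ((n : ℝ) - 1) / ((n : ℝ) - (k : ℝ)) * (n.choose j : ℝ)
  have hcard := Finset.card_filter_add_card_filter_not (s := Finset.Icc 1 (n - 1)) P
  rw [Nat.card_Icc] at hcard
  set bad := Finset.filter (fun j => ¬ P j) (Finset.Icc 1 (n - 1)) with hbad
  -- Of `n - 1` indices at most `k - 1` are good. As `k < n`, the bad set is also nonempty, which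
  -- makes the next sum inequality strict.
  have hbc : n - k ≤ bad.card := by
    have : (Finset.filter P (Finset.Icc 1 (n - 1))).card < k := hlt
    omega
  have hne : bad.Nonempty := Finset.card_pos.1 (by omega)
  have hn1 : (0 : ℝ) ≤ (n : ℝ) - 1 := sub_nonneg.2 (by exact_mod_cast Nat.one_le_iff_ne_zero.2 hn)
  have h1 : ∑ _j ∈ bad, ((n : ℝ) - 1) / ((n : ℝ) - k) < ∑ j ∈ bad, V j / n.choose j := by
    refine Finset.sum_lt_sum_of_nonempty hne fun j hj => ?_
    obtain ⟨hj1, hj2⟩ := Finset.mem_filter.1 hj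
    have hc : (0 : ℝ) < n.choose j := by
      exact_mod_cast Nat.choose_pos (by have := Finset.mem_Icc.1 hj1; omega)
    rw [lt_div_iff₀ hc]
    exact not_le.1 hj2
  have h2 : ∑ j ∈ bad, V j / n.choose j ≤ ∑ j ∈ Finset.Icc 1 (n - 1), V j / n.choose j :=
    Finset.sum_le_sum_of_subset_of_nonneg (Finset.filter_subset _ _) fun j hj _ =>
      div_nonneg (Godbersen.mixedVolumePair_nonneg hn hK hL
        (by have := Finset.mem_Icc.1 hj; omega)) (Nat.cast_nonneg _)
  have h3 : (n : ℝ) - 1 ≤ ∑ _j ∈ bad, ((n : ℝ) - 1) / ((n : ℝ) - k) := by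
    rw [Finset.sum_const, nsmul_eq_mul]
    have h4 : (n : ℝ) - k ≤ bad.card := by
      rw [← Nat.cast_sub hk.le]; exact_mod_cast hbc
    calc (n : ℝ) - 1 = ((n : ℝ) - k) * (((n : ℝ) - 1) / ((n : ℝ) - k)) := by field_simp
      _ ≤ _ := by gcongr
  linarith
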